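/- **Theorem 3.2.** Let $\Gamma\subset\mathbf Q^*$ be a finitely generated subgroup. Put $$\Gamma_\infty=\{x\in\mathbf C^*: x^n\in\Gamma\text{ for some }n\ge1\},\qquad \Gamma_{p^\infty}=\{x\in\mathbf C^*: x^{p^n}\in\Gamma\text{ for some }n\ge 1\}\quad(p\text{ prime}).$$ Let $A=\mathrm{Aut}_{\Gamma_\infty\cap\mathbf Q^*}(\Gamma_\infty)$ be the group of group automorphisms of $\Gamma_\infty$ that are the identity on $\Gamma_\infty\cap\mathbf Q^*$, and let $A_p=\mathrm{Aut}_{\Gamma_{p^\infty}\cap\mathbf Q^*}(\Gamma_{p^\infty})$ be defined likewise. These are profinite groups in the topology of pointwise convergence, and restriction of automorphisms gives an isomorphism $A\cong\prod_pA_p$, by which we identify these two groups. Let $G=\mathrm{Gal}(\mathbf Q(\Gamma_\infty)/\mathbf Q)$, viewed as a subgroup of $A$ by its action on $\Gamma_\infty$. Let $\nu_p$ be the Haar measure on $A_p$ with $\nu_p(A_p)=1$, and let $\nu=\prod_p\nu_p$, the normalized Haar measure on $A$. Then $G$ is normal in $A$, $\nu(G)>0$, and the dual group $X=\mathrm{Hom}(A/G,\mu_2)$,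 with $\mu_2=\{\pm1\}$, is finite. For each $\chi\in X$, viewed as a character of $A$, let $\chi_p:A_p\to\mu_2$ be its restriction to the factor $A_p$ of $A=\prod_pA_p$. The characters $\chi_p$ are continuous, all but finitely many of them are trivial, and $\chi(\alpha)=\prod_p\chi_p(\alpha_p)$ for all $\alpha=(\alpha_p)_p\in A$. Moreover, for every product $S=\prod_pS_p\subset A$ of $\nu_p$-measurable sets $S_p\subset A_p$ with $\nu_p(S_p)>0$ for all $p$, we have $$\delta(S)=\frac{\nu(G\cap S)}{\nu(G)}=E\cdot\frac{\nu(S)}{\nu(A)},\qquad E=\sum_{\chi\in X}\ \prod_pE_{\chi,p},\qquad E_{\chi,p}=\frac1{\nu_p(S_p)}\int_{S_p}\chi_p\,d\nu_p .$$ -/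

import Mathlib

open MeasureTheory Topology

/-! ### Topology of pointwise convergence on automorphism groups of discrete groups -/

section Pointwise

/-- The topology of pointwise convergence on the group of automorphisms of a (discrete) group `X`:
the sets `{α | α x = y}` form a subbasis. -/
instance pointwiseTopology (X : Type*) [Group X] : TopologicalSpace (MulAut X) :=
  ⨅ x : X, TopologicalSpace.induced (fun α : MulAut X => α x) ⊥

instance pointwiseMeasurableSpace (X : Type*) [Group X] : MeasurableSpace (MulAut X) :=
  borel (MulAut X)

instance pointwiseBorelSpace (X : Type*) [Group X] : BorelSpace (MulAut X) := ⟨rfl⟩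

theorem isOpen_apply_eq {X : Type*} [Group X] (x y : X) : IsOpen {α : MulAut X | α x = y} := by
  have h : IsOpen[TopologicalSpace.induced (fun α : MulAut X => α x) ⊥]
      {α : MulAut X | α x = y} := by
    let _ : TopologicalSpace X := ⊥
    exact ⟨{y}, trivial, rfl⟩
  exact (iInf_le (fun x : X => TopologicalSpace.induced (fun α : MulAut X => α x) ⊥) x) _ h

theorem isClosed_apply_eq {X : Type*} [Group X] (x y : X) : IsClosed {α : MulAut X | α x = y} := by
  rw [← isOpen_compl_iff]
  have : {α : MulAut X | α x = y}ᶜ = ⋃ z ∈ {z : X | z ≠ y}, {α : MulAut X | α x = z} := by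
    ext α; simp
  rw [this]
  exact isOpen_biUnion fun z _ => isOpen_apply_eq x z

theorem tendsto_mulAut {X ι : Type*} [Group X] {l : Filter ι} {f : ι → MulAut X} {β : MulAut X}
    (h : ∀ x, ∀ᶠ i in l, f i x = β x) : Filter.Tendsto f l (nhds β) := by
  have : nhds β = ⨅ x : X, Filter.comap (fun α : MulAut X => α x) (pure (β x)) := by
    unfold pointwiseTopology
    rw [nhds_iInf]
    refine iInf_congr fun x => ?_
    let _ : TopologicalSpace X := ⊥
    have : DiscreteTopology X := ⟨rfl⟩
    rw [nhds_induced, nhds_discrete]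
  rw [this, Filter.tendsto_iInf]
  intro x
  rw [Filter.tendsto_comap_iff, Filter.tendsto_pure]
  exact h x

theorem continuous_mulAut {X Y : Type*} [Group X] [TopologicalSpace Y] {f : Y → MulAut X}
    (h : ∀ x y, IsOpen {i | f i x = y}) : Continuous f := by
  rw [continuous_iff_continuousAt]
  intro i
  exact tendsto_mulAut fun x => (h x (f i x)).mem_nhds rfl

instance pointwiseIsTopologicalGroup (X : Type*) [Group X] : IsTopologicalGroup (MulAut X) where
  continuous_mul := by
    refine continuous_mulAut fun x y => ?_
    have : {i : MulAut X × MulAut X | (i.1 * i.2) x = y} =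
        ⋃ z : X, {α : MulAut X | α z = y} ×ˢ {α : MulAut X | α x = z} := by
      ext i; simp
    rw [this]
    exact isOpen_iUnion fun z => (isOpen_apply_eq z y).prod (isOpen_apply_eq x z)
  continuous_inv := by
    refine continuous_mulAut fun x y => ?_
    have : {α : MulAut X | α⁻¹ x = y} = {α : MulAut X | α y = x} := by
      ext α
      simp only [Set.mem_ofPred_eq]
      rw [MulAut.inv_apply, MulEquiv.symm_apply_eq, eq_comm]
    exact this ▸ isOpen_apply_eq y x

instance pointwiseT2Space (X : Type*) [Group X] : T2Space (MulAut X) := by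
  refine ⟨fun α β h => ?_⟩
  obtain ⟨x, hx⟩ : ∃ x, α x ≠ β x := by
    by_contra! H
    exact h (MulEquiv.ext H)
  refine ⟨_, _, isOpen_apply_eq x (α x), isOpen_apply_eq x (β x), rfl, rfl, ?_⟩
  rw [Set.disjoint_left]
  rintro γ (h1 : γ x = _) (h2 : γ x = _)
  exact hx (h1.symm.trans h2)

/-- The automorphisms fixing `s` pointwise form a compact group if all their orbits are finite. -/
theorem compactSpace_fixingSubgroup {X : Type*} [Group X] (s : Set X)
    (h : ∀ x : X, ∃ F : Set X, F.Finite ∧ ∀ α ∈ fixingSubgroup (MulAut X) s, α x ∈ F) :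
    CompactSpace (fixingSubgroup (MulAut X) s) := by
  suffices IsCompact (fixingSubgroup (MulAut X) s : Set (MulAut X)) from
    isCompact_iff_compactSpace.1 this
  rw [isCompact_iff_ultrafilter_le_nhds]
  intro U hU
  have hU' : ∀ᶠ α in (U : Filter (MulAut X)), α ∈ fixingSubgroup (MulAut X) s := by
    exact Filter.le_principal_iff.1 hU
  have key : ∀ g : MulAut X → MulAut X,
      (∀ α ∈ fixingSubgroup (MulAut X) s, g α ∈ fixingSubgroup (MulAut X) s) →
      ∀ x, ∃ y, ∀ᶠ α in (U : Filter (MulAut X)), g α x = y := by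
    intro g hg x
    obtain ⟨F, hF, hF'⟩ := h x
    have := (Ultrafilter.eventually_exists_mem_iff (f := U) hF
      (P := fun y α => g α x = y)).1 (hU'.mono fun α hα => ⟨_, hF' _ (hg α hα), rfl⟩)
    obtain ⟨y, -, hy⟩ := this
    exact ⟨y, hy⟩
  choose f hf using key id fun _ h => h
  choose f' hf' using key (fun α => α⁻¹) fun _ h => inv_mem h
  have ff' : ∀ x, f (f' x) = x := by
    intro x
    obtain ⟨α, h1, h2⟩ := ((hf (f' x)).and (hf' x)).exists
    rw [← h1, ← h2]; simp
  have f'f : ∀ x, f' (f x) = x := by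
    intro x
    obtain ⟨α, h1, h2⟩ := ((hf x).and (hf' (f x))).exists
    rw [← h2, ← h1]; simp
  let β : MulAut X :=
    { toFun := f, invFun := f', left_inv := f'f, right_inv := ff'
      map_mul' := by
        intro x y
        obtain ⟨α, ⟨h1, h2⟩, h3⟩ := (((hf x).and (hf y)).and (hf (x * y))).exists
        rw [← h1, ← h2, ← h3]; simp }
  refine ⟨β, ?_, ?_⟩
  · rw [SetLike.mem_coe, mem_fixingSubgroup_iff]
    intro x hx
    obtain ⟨α, h1, h2⟩ := ((hf x).and hU').exists
    have := (mem_fixingSubgroup_iff _).1 h2 x hx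
    rw [MulAut.smul_def] at this ⊢
    exact h1.symm.trans this
  · exact tendsto_mulAut (f := id) (β := β) hf

theorem secondCountable_mulAut (X : Type*) [Group X] [Countable X] :
    SecondCountableTopology (MulAut X) := by
  unfold pointwiseTopology
  refine TopologicalSpace.secondCountableTopology_iInf fun x => ?_
  let _ : TopologicalSpace X := ⊥
  have : DiscreteTopology X := ⟨rfl⟩
  exact TopologicalSpace.secondCountableTopology_induced _ _ _

end Pointwise

/-! ### Groups of radicals -/

/-- The inclusion `ℚˣ → ℂˣ`. -/
noncomputable def ratUnits : ℚˣ →* ℂˣ := Units.map (algebraMap ℚ ℂ : ℚ →* ℂ)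

/-- The group of complex numbers `x ≠ 0` with `x ^ n ∈ Γ` for some exponent `n ∈ M`. -/
def radicals (Γ : Subgroup ℚˣ) (M : Submonoid ℕ) : Subgroup ℂˣ where
  carrier := {x | ∃ n ∈ M, x ^ n ∈ Γ.map ratUnits}
  one_mem' := ⟨1, M.one_mem, by simp [one_mem]⟩
  mul_mem' := by
    rintro x y ⟨m, hm, hx⟩ ⟨n, hn, hy⟩
    refine ⟨m * n, mul_mem hm hn, ?_⟩
    rw [mul_pow, pow_mul, mul_comm m n, pow_mul]
    exact mul_mem (pow_mem hx _) (pow_mem hy _)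
  inv_mem' := by
    rintro x ⟨n, hn, hx⟩
    exact ⟨n, hn, by rw [inv_pow]; exact inv_mem hx⟩

/-- `Γ_∞`: all radicals of arbitrary order `n ≥ 1` of elements of `Γ`. -/
abbrev radicalsInf (Γ : Subgroup ℚˣ) : Subgroup ℂˣ := radicals Γ (nonZeroDivisors ℕ)

/-- `Γ_{p^∞}`: all radicals of `p`-power order of elements of `Γ`. -/
abbrev radicalsPrim (Γ : Subgroup ℚˣ) (p : Nat.Primes) : Subgroup ℂˣ :=
  radicals Γ (Submonoid.powers (p : ℕ))

/-- The group of those group automorphisms of `radicals Γ M` that are the identity on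
`radicals Γ M ∩ ℚˣ`. -/
abbrev radicalAut (Γ : Subgroup ℚˣ) (M : Submonoid ℕ) : Subgroup (MulAut (radicals Γ M)) :=
  fixingSubgroup (MulAut (radicals Γ M)) {x : radicals Γ M | (x : ℂˣ) ∈ ratUnits.range}

/-- `A = Aut_{Γ_∞ ∩ ℚˣ}(Γ_∞)`. -/
abbrev autInf (Γ : Subgroup ℚˣ) : Subgroup (MulAut (radicalsInf Γ)) :=
  radicalAut Γ (nonZeroDivisors ℕ)

/-- `A_p = Aut_{Γ_{p^∞} ∩ ℚˣ}(Γ_{p^∞})`. -/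
abbrev autPrim (Γ : Subgroup ℚˣ) (p : Nat.Primes) : Subgroup (MulAut (radicalsPrim Γ p)) :=
  radicalAut Γ (Submonoid.powers (p : ℕ))

theorem radicalAut_apply {Γ : Subgroup ℚˣ} {M : Submonoid ℕ} (α : radicalAut Γ M)
    {x : radicals Γ M} (hx : (x : ℂˣ) ∈ ratUnits.range) : (α : MulAut (radicals Γ M)) x = x :=
  (mem_fixingSubgroup_iff _).1 α.2 x hx

theorem map_le_range (Γ : Subgroup ℚˣ) {x : ℂˣ} (hx : x ∈ Γ.map ratUnits) :
    x ∈ ratUnits.range := by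
  obtain ⟨q, -, rfl⟩ := hx
  exact ⟨q, rfl⟩

theorem radicalAut_pow {Γ : Subgroup ℚˣ} {M : Submonoid ℕ} (α : radicalAut Γ M)
    {x : radicals Γ M} {n : ℕ} (hx : (x : ℂˣ) ^ n ∈ ratUnits.range) :
    (((α : MulAut (radicals Γ M)) x : radicals Γ M) : ℂˣ) ^ n = (x : ℂˣ) ^ n := by
  have := radicalAut_apply α (x := x ^ n) (by simpa using hx)
  rw [map_pow] at this
  simpa using congrArg (Subtype.val) this

theorem finite_units_pow_eq {n : ℕ} (hn : n ≠ 0) (y : ℂˣ) : {x : ℂˣ | x ^ n = y}.Finite := by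
  have : {z : ℂ | z ^ n = (y : ℂ)}.Finite := by
    refine (Polynomial.nthRoots n (y : ℂ)).toFinset.finite_toSet.subset fun z hz => ?_
    simpa [Polynomial.mem_nthRoots (Nat.pos_of_ne_zero hn)] using hz
  refine Set.Finite.of_finite_image (f := fun u : ℂˣ => (u : ℂ)) (this.subset ?_)
    (Units.val_injective.injOn)
  rintro _ ⟨x, hx, rfl⟩
  have hx : x ^ n = y := hx
  simp [← hx]

theorem compactSpace_radicalAut (Γ : Subgroup ℚˣ) {M : Submonoid ℕ} (hM : 0 ∉ M) :
    CompactSpace (radicalAut Γ M) := by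
  refine compactSpace_fixingSubgroup _ fun x => ?_
  obtain ⟨n, hn, hx⟩ := x.2
  have hn0 : n ≠ 0 := fun h => hM (h ▸ hn)
  refine ⟨{y | (y : ℂˣ) ^ n = (x : ℂˣ) ^ n}, ?_, fun α hα => ?_⟩
  · exact (finite_units_pow_eq hn0 _).preimage Subtype.val_injective.injOn
  · exact radicalAut_pow ⟨α, hα⟩ (map_le_range Γ hx)

theorem countable_radicals (Γ : Subgroup ℚˣ) {M : Submonoid ℕ} (hM : 0 ∉ M) :
    Countable (radicals Γ M) := by
  have h : ((radicals Γ M : Subgroup ℂˣ) : Set ℂˣ) ⊆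
      ⋃ n ∈ (M : Set ℕ), ⋃ q : ℚˣ, {x : ℂˣ | x ^ n = ratUnits q} := by
    rintro x ⟨n, hn, q, -, hq⟩
    simp only [Set.mem_iUnion]
    exact ⟨n, hn, q, hq.symm⟩
  refine Set.Countable.mono h ((Set.to_countable _).biUnion fun n hn => ?_)
  have : Countable ℚˣ := Units.val_injective.countable
  exact Set.countable_iUnion fun q =>
    (finite_units_pow_eq (fun h => hM (h ▸ hn)) _).countable

instance compactSpace_autInf (Γ : Subgroup ℚˣ) : CompactSpace (autInf Γ) :=
  compactSpace_radicalAut Γ (by simp)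

theorem zero_notMem_powers (p : Nat.Primes) : 0 ∉ Submonoid.powers (p : ℕ) := by
  rintro ⟨k, hk⟩
  exact p.2.ne_zero (eq_zero_of_pow_eq_zero hk)

instance compactSpace_autPrim (Γ : Subgroup ℚˣ) (p : Nat.Primes) : CompactSpace (autPrim Γ p) :=
  compactSpace_radicalAut Γ (zero_notMem_powers p)

/-! ### The decomposition `A ≃ ∏ p, A_p` -/

theorem radicals_mono (Γ : Subgroup ℚˣ) {M N : Submonoid ℕ} (h : M ≤ N) :
    radicals Γ M ≤ radicals Γ N := by
  rintro x ⟨n, hn, hx⟩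
  exact ⟨n, h hn, hx⟩

theorem powers_le (p : Nat.Primes) : Submonoid.powers (p : ℕ) ≤ nonZeroDivisors ℕ := by
  rw [Submonoid.powers_le]
  simpa using p.2.ne_zero

theorem radicalAut_mem {Γ : Subgroup ℚˣ} {M N : Submonoid ℕ} (α : radicalAut Γ N)
    {x : radicals Γ N} (hx : (x : ℂˣ) ∈ radicals Γ M) :
    (((α : MulAut (radicals Γ N)) x : radicals Γ N) : ℂˣ) ∈ radicals Γ M := by
  obtain ⟨n, hn, hxn⟩ := hx
  refine ⟨n, hn, ?_⟩
  rwa [radicalAut_pow α (map_le_range Γ hxn)]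

/-- Restriction of automorphisms from `radicals Γ N` to the subgroup `radicals Γ M`. -/
def radicalRes (Γ : Subgroup ℚˣ) {M N : Submonoid ℕ} (h : M ≤ N) :
    radicalAut Γ N →* radicalAut Γ M where
  toFun α :=
    ⟨{ toFun := fun x => ⟨((α : MulAut (radicals Γ N)) ⟨x, radicals_mono Γ h x.2⟩ : radicals Γ N),
          radicalAut_mem α x.2⟩
       invFun := fun x =>
          ⟨((α⁻¹ : radicalAut Γ N) : MulAut (radicals Γ N)) ⟨x, radicals_mono Γ h x.2⟩,
          radicalAut_mem α⁻¹ x.2⟩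
       left_inv := fun x => by ext; simp
       right_inv := fun x => by ext; simp
       map_mul' := fun x y => by
        have := map_mul (α : MulAut (radicals Γ N)) ⟨x, radicals_mono Γ h x.2⟩
          ⟨y, radicals_mono Γ h y.2⟩
        exact Subtype.ext (congrArg (fun z : radicals Γ N => (z : ℂˣ)) this) },
      by
        rw [mem_fixingSubgroup_iff]
        intro x hx
        ext
        simp only [MulAut.smul_def, MulEquiv.coe_mk, Equiv.coe_fn_mk]
        rw [radicalAut_apply α (x := ⟨x, radicals_mono Γ h x.2⟩) hx]⟩
  map_one' := by ext; simp
  map_mul' α β := by ext; simp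

/-- The homomorphism `A → ∏ p, A_p` that restricts automorphisms to the groups `Γ_{p^∞}`. -/
def autRes (Γ : Subgroup ℚˣ) : autInf Γ →* ∀ p : Nat.Primes, autPrim Γ p :=
  MonoidHom.pi fun p => radicalRes Γ (powers_le p)

theorem autRes_apply (Γ : Subgroup ℚˣ) (α : autInf Γ) (p : Nat.Primes) (x : radicalsPrim Γ p) :
    (((autRes Γ α p : MulAut (radicalsPrim Γ p)) x : radicalsPrim Γ p) : ℂˣ) =
      (α : MulAut (radicalsInf Γ)) ⟨x, radicals_mono Γ (powers_le p) x.2⟩ := rfl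

theorem mem_prim {Γ : Subgroup ℚˣ} {x : ℂˣ} {N : ℕ} (hx : x ^ N ∈ Γ.map ratUnits)
    (p : Nat.Primes) : x ^ (ordCompl[p] N) ∈ radicalsPrim Γ p := by
  refine ⟨ordProj[p] N, ⟨_, rfl⟩, ?_⟩
  rwa [← pow_mul, mul_comm, Nat.ordProj_mul_ordCompl_eq_self]

/-- `y` is the image of `x` under the automorphism glued from the `α p`, as tested at the
exponent `N` (with `x ^ N ∈ Γ`). -/
def Glued (Γ : Subgroup ℚˣ) (α : ∀ p : Nat.Primes, autPrim Γ p) (N : ℕ) (x y : ℂˣ) : Prop :=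
  ∃ hx : x ^ N ∈ Γ.map ratUnits, ∀ p : Nat.Primes,
    y ^ (ordCompl[p] N) = ((α p : MulAut (radicalsPrim Γ p)) ⟨_, mem_prim hx p⟩ : radicalsPrim Γ p)

theorem exists_bezout {N : ℕ} (hN : N ≠ 0) :
    ∃ c : Nat.Primes →₀ ℤ, (c.sum fun p a => a * (ordCompl[p] N : ℕ)) = 1 := by
  have h : (1 : ℤ) ∈ Ideal.span (Set.range fun p : Nat.Primes => ((ordCompl[p] N : ℕ) : ℤ)) := by
    obtain ⟨d, hd⟩ := (IsPrincipalIdealRing.principal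
      (Ideal.span (Set.range fun p : Nat.Primes => ((ordCompl[p] N : ℕ) : ℤ)))).principal
    have hdiv : ∀ p : Nat.Primes, d ∣ ((ordCompl[p] N : ℕ) : ℤ) := by
      intro p
      have : ((ordCompl[p] N : ℕ) : ℤ) ∈
          Ideal.span (Set.range fun p : Nat.Primes => ((ordCompl[p] N : ℕ) : ℤ)) :=
        Ideal.subset_span ⟨p, rfl⟩
      rw [hd] at this
      exact Ideal.mem_span_singleton.1 this
    have hu : d.natAbs = 1 := by
      by_contra hne
      obtain ⟨q, hq, hqd⟩ := Nat.exists_prime_and_dvd hne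
      have h1 : q ∣ ordCompl[q] N :=
        hqd.trans (Int.natAbs_dvd_natAbs.2 (hdiv ⟨q, hq⟩))
      exact Nat.not_dvd_ordCompl hq hN h1
    rw [hd]
    exact Ideal.mem_span_singleton.2 (Int.isUnit_iff_natAbs_eq.2 hu).dvd
  exact Finsupp.mem_ideal_span_range_iff_exists_finsupp.1 h

theorem prod_zpow_eq {ι : Type*} (z : ℂˣ) (s : Finset ι) (f : ι → ℤ) :
    ∏ i ∈ s, z ^ f i = z ^ (∑ i ∈ s, f i) := by
  classical
  induction s using Finset.induction_on with
  | empty => simp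
  | insert a s ha ih => rw [Finset.prod_insert ha, Finset.sum_insert ha, ih, zpow_add]

theorem eq_one_of_forall_pow {N : ℕ} (hN : N ≠ 0) {z : ℂˣ}
    (h : ∀ p : Nat.Primes, z ^ (ordCompl[p] N) = 1) : z = 1 := by
  obtain ⟨c, hc⟩ := exists_bezout hN
  rw [← zpow_one z, ← hc, Finsupp.sum]
  rw [← prod_zpow_eq]
  refine Finset.prod_eq_one fun p _ => ?_
  rw [mul_comm, zpow_mul, zpow_natCast, h, one_zpow]

theorem Glued.mul_right {Γ : Subgroup ℚˣ} {α : ∀ p : Nat.Primes, autPrim Γ p} {N : ℕ} {x y : ℂˣ}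
    (h : Glued Γ α N x y) (K : ℕ) : Glued Γ α (N * K) x y := by
  obtain ⟨hx, h⟩ := h
  refine ⟨by rw [pow_mul]; exact pow_mem hx K, fun p => ?_⟩
  have key : ∀ (m a b : ℕ) (hm : m = a * b) (h1 : x ^ a ∈ radicalsPrim Γ p)
      (h2 : x ^ m ∈ radicalsPrim Γ p),
      y ^ a = ((α p : MulAut (radicalsPrim Γ p)) ⟨_, h1⟩ : radicalsPrim Γ p) →
      y ^ m = ((α p : MulAut (radicalsPrim Γ p)) ⟨_, h2⟩ : radicalsPrim Γ p) := by
    rintro m a b rfl h1 h2 h3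
    have h4 : (⟨x ^ (a * b), h2⟩ : radicalsPrim Γ p) = ⟨x ^ a, h1⟩ ^ b :=
      Subtype.ext (pow_mul x a b)
    rw [pow_mul, h3, h4, map_pow, SubmonoidClass.coe_pow]
  exact key _ _ _ (Nat.ordCompl_mul N K p) _ _ (h p)

theorem Glued.unique {Γ : Subgroup ℚˣ} {α : ∀ p : Nat.Primes, autPrim Γ p} {N K : ℕ}
    (hN : N ≠ 0) (hK : K ≠ 0) {x y z : ℂˣ}
    (h : Glued Γ α N x y) (h' : Glued Γ α K x z) : y = z := by
  obtain ⟨hx, h⟩ := h.mul_right K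
  obtain ⟨hx', h'⟩ := mul_comm K N ▸ h'.mul_right N
  rw [← div_eq_one]
  refine eq_one_of_forall_pow (mul_ne_zero hN hK) fun p => ?_
  rw [div_pow, h p, h' p, div_self']

theorem Glued.mul {Γ : Subgroup ℚˣ} {α : ∀ p : Nat.Primes, autPrim Γ p} {N K : ℕ}
    {x y x' y' : ℂˣ} (h : Glued Γ α N x y) (h' : Glued Γ α K x' y') :
    Glued Γ α (N * K) (x * x') (y * y') := by
  obtain ⟨hx, h⟩ := h.mul_right K
  obtain ⟨hx', h'⟩ := mul_comm K N ▸ h'.mul_right N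
  refine ⟨by rw [mul_pow]; exact mul_mem hx hx', fun p => ?_⟩
  rw [mul_pow, h p, h' p, ← MulMemClass.coe_mul, ← map_mul]
  simp only [MulMemClass.mk_mul_mk, mul_pow]

theorem Glued.comp {Γ : Subgroup ℚˣ} {α β : ∀ p : Nat.Primes, autPrim Γ p} {N K : ℕ}
    {x y z : ℂˣ} (h : Glued Γ α N x y) (h' : Glued Γ β K y z) :
    Glued Γ (β * α) (N * K) x z := by
  obtain ⟨hx, h⟩ := h.mul_right K
  obtain ⟨hx', h'⟩ := mul_comm K N ▸ h'.mul_right N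
  refine ⟨hx, fun p => ?_⟩
  rw [h' p]
  simp only [h p]
  rfl

theorem glued_of_range {Γ : Subgroup ℚˣ} (α : ∀ p : Nat.Primes, autPrim Γ p) {N : ℕ} {x : ℂˣ}
    (hx : x ^ N ∈ Γ.map ratUnits) (hr : x ∈ ratUnits.range) : Glued Γ α N x x := by
  refine ⟨hx, fun p => ?_⟩
  rw [radicalAut_apply (α p) (x := ⟨_, mem_prim hx p⟩) (pow_mem hr _)]

theorem glued_one {Γ : Subgroup ℚˣ} {N : ℕ} {x : ℂˣ}
    (hx : x ^ N ∈ Γ.map ratUnits) : Glued Γ 1 N x x := ⟨hx, fun p => by simp⟩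

theorem glued_autRes {Γ : Subgroup ℚˣ} (α : autInf Γ) {N : ℕ} (x : radicalsInf Γ)
    (hx : (x : ℂˣ) ^ N ∈ Γ.map ratUnits) :
    Glued Γ (autRes Γ α) N x ((α : MulAut (radicalsInf Γ)) x : radicalsInf Γ) := by
  refine ⟨hx, fun p => ?_⟩
  rw [autRes_apply, ← SubmonoidClass.coe_pow, ← map_pow]
  rfl

theorem glued_prim {Γ : Subgroup ℚˣ} (α : ∀ p : Nat.Primes, autPrim Γ p) (p : Nat.Primes)
    (x : radicalsPrim Γ p) : ∃ N ≠ 0,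
    Glued Γ α N x ((α p : MulAut (radicalsPrim Γ p)) x : radicalsPrim Γ p) := by
  obtain ⟨n, ⟨k, rfl⟩, hx⟩ := x.2
  refine ⟨(p : ℕ) ^ k, pow_ne_zero _ p.2.ne_zero, hx, fun q => ?_⟩
  by_cases hqp : q = p
  · subst hqp
    have : ordCompl[q] ((q : ℕ) ^ k) = 1 := Nat.ordCompl_self_pow q.2
    simp only [this, pow_one]
  · have h1 : ordCompl[q] ((p : ℕ) ^ k) = (p : ℕ) ^ k := by
      refine (Nat.ordCompl_eq_self_iff_zero_or_not_dvd _ q.2).2 (Or.inr fun hd => hqp ?_)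
      exact Subtype.ext ((Nat.prime_dvd_prime_iff_eq q.2 p.2).1 (q.2.dvd_of_dvd_pow hd))
    rw [radicalAut_apply (α q) (x := ⟨_, mem_prim hx q⟩)
      (by simp only [h1]; exact map_le_range Γ hx)]
    simp only [h1]
    exact radicalAut_pow (α p) (map_le_range Γ hx)

theorem exists_glued {Γ : Subgroup ℚˣ} (α : ∀ p : Nat.Primes, autPrim Γ p) {N : ℕ} (hN : N ≠ 0)
    {x : ℂˣ} (hx : x ^ N ∈ Γ.map ratUnits) : ∃ y, Glued Γ α N x y := by
  obtain ⟨c, hc⟩ := exists_bezout hN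
  set w : Nat.Primes → ℂˣ := fun p =>
    ((α p : MulAut (radicalsPrim Γ p)) ⟨_, mem_prim hx p⟩ : radicalsPrim Γ p) with hw
  have key : ∀ p q : Nat.Primes, w p ^ (ordCompl[q] N) = w q ^ (ordCompl[p] N) := by
    intro p q
    by_cases hpq : p = q
    · rw [hpq]
    have hdvd : N ∣ ordCompl[p] N * ordCompl[q] N := by
      have hcop : Nat.Coprime (ordProj[(p : ℕ)] N) (ordProj[(q : ℕ)] N) :=
        Nat.Coprime.pow (N.factorization p) (N.factorization q) ((Nat.coprime_primes p.2 q.2).2 fun h => hpq (Subtype.ext h))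
      have h1 : ordProj[(p : ℕ)] N ∣ ordCompl[(q : ℕ)] N := by
        refine hcop.dvd_of_dvd_mul_left ?_
        rw [Nat.ordProj_mul_ordCompl_eq_self]
        exact Nat.ordProj_dvd N p
      calc N = ordCompl[(p : ℕ)] N * ordProj[(p : ℕ)] N := by
            rw [mul_comm, Nat.ordProj_mul_ordCompl_eq_self]
        _ ∣ _ := mul_dvd_mul_left _ h1
    have hmem : x ^ (ordCompl[p] N * ordCompl[q] N) ∈ Γ.map ratUnits := by
      obtain ⟨k, hk⟩ := hdvd
      rw [hk, pow_mul]
      exact pow_mem hx k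
    have h1 : w p ^ (ordCompl[q] N) = x ^ (ordCompl[p] N * ordCompl[q] N) := by
      rw [pow_mul]
      exact radicalAut_pow (α p) (x := ⟨_, mem_prim hx p⟩)
        (by simpa only [← pow_mul] using map_le_range Γ hmem)
    have h2 : w q ^ (ordCompl[p] N) = x ^ (ordCompl[p] N * ordCompl[q] N) := by
      rw [mul_comm, pow_mul]
      refine radicalAut_pow (α q) (x := ⟨_, mem_prim hx q⟩) ?_
      rw [mul_comm] at hmem
      simpa only [← pow_mul] using map_le_range Γ hmem
    rw [h1, h2]
  refine ⟨∏ p ∈ c.support, w p ^ c p, hx, fun q => ?_⟩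
  change _ = w q
  calc (∏ p ∈ c.support, w p ^ c p) ^ (ordCompl[q] N)
      = ∏ p ∈ c.support, w q ^ (c p * (ordCompl[p] N : ℕ)) := by
        rw [← Finset.prod_pow]
        refine Finset.prod_congr rfl fun p _ => ?_
        rw [← zpow_natCast (w p ^ c p), zpow_comm, zpow_natCast, key p q, mul_comm (c p), zpow_mul,
          zpow_natCast]
    _ = w q := by
        rw [prod_zpow_eq]
        change w q ^ (c.sum fun p a => a * (ordCompl[p] N : ℕ)) = w q
        rw [hc, zpow_one]

theorem exists_glued' {Γ : Subgroup ℚˣ} (α : ∀ p : Nat.Primes, autPrim Γ p)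
    (x : radicalsInf Γ) : ∃ y : radicalsInf Γ, ∃ N ≠ 0, Glued Γ α N x y := by
  obtain ⟨N, hN, hx⟩ := x.2
  have hN : N ≠ 0 := by simpa using hN
  obtain ⟨y, hy⟩ := exists_glued α hN hx
  obtain ⟨y', hy'⟩ := exists_glued α⁻¹ (x := x) hN hx
  refine ⟨⟨y, N, by simpa using hN, ?_⟩, N, hN, hy⟩
  have h1 : Glued Γ α (N ^ N) ((x : ℂˣ) ^ N) (y ^ N) := by
    have : ∀ k, Glued Γ α (N ^ k) ((x : ℂˣ) ^ k) (y ^ k) := by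
      intro k
      induction k with
      | zero => simpa using glued_of_range α (N := 1) (x := 1) (by simp [one_mem]) (one_mem _)
      | succ k ih => rw [pow_succ, pow_succ, pow_succ]; exact ih.mul hy
    exact this N
  have h2 : Glued Γ α 1 ((x : ℂˣ) ^ N) ((x : ℂˣ) ^ N) :=
    glued_of_range α (by simpa using hx) (map_le_range Γ hx)
  rw [h1.unique (pow_ne_zero _ hN) one_ne_zero h2]
  exact hx

theorem autRes_bijective (Γ : Subgroup ℚˣ) : Function.Bijective (autRes Γ) := by
  constructor
  · intro α β h
    refine Subtype.ext (MulEquiv.ext fun x => Subtype.ext ?_)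
    obtain ⟨N, hN, hx⟩ := x.2
    have hN : N ≠ 0 := by simpa using hN
    exact (glued_autRes α x hx).unique hN hN (h ▸ glued_autRes β x hx)
  · intro α
    choose f N hN hf using exists_glued' α
    choose g K hK hg using exists_glued' α⁻¹
    have hgf : ∀ x, g (f x) = x := by
      intro x
      obtain ⟨M, hM, hx⟩ := x.2
      have hM : M ≠ 0 := by simpa using hM
      have := (hf x).comp (hg (f x))
      rw [inv_mul_cancel] at this
      exact Subtype.ext (this.unique (mul_ne_zero (hN _) (hK _)) hM (glued_one hx))
    have hfg : ∀ x, f (g x) = x := by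
      intro x
      obtain ⟨M, hM, hx⟩ := x.2
      have hM : M ≠ 0 := by simpa using hM
      have := (hg x).comp (hf (g x))
      rw [mul_inv_cancel] at this
      exact Subtype.ext (this.unique (mul_ne_zero (hK _) (hN _)) hM (glued_one hx))
    let F : MulAut (radicalsInf Γ) :=
      { toFun := f, invFun := g, left_inv := hgf, right_inv := hfg
        map_mul' := fun x y => Subtype.ext
          ((hf (x * y)).unique (hN _) (mul_ne_zero (hN _) (hN _)) ((hf x).mul (hf y))) }
    have hF : F ∈ autInf Γ := by
      rw [mem_fixingSubgroup_iff]
      intro x hr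
      obtain ⟨M, hM, hx⟩ := x.2
      have hM : M ≠ 0 := by simpa using hM
      exact Subtype.ext ((hf x).unique (hN _) hM (glued_of_range α hx hr))
    refine ⟨⟨F, hF⟩, ?_⟩
    funext p
    refine Subtype.ext (MulEquiv.ext fun x => Subtype.ext ?_)
    obtain ⟨M, hM, hx⟩ := glued_prim α p x
    exact (hf ⟨x, radicals_mono Γ (powers_le p) x.2⟩).unique (hN _) hM hx

/-- The natural isomorphism `A ≃ ∏ p, A_p`. -/
noncomputable def autEquiv (Γ : Subgroup ℚˣ) : autInf Γ ≃* ∀ p : Nat.Primes, autPrim Γ p :=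
  MulEquiv.ofBijective (autRes Γ) (autRes_bijective Γ)

/-! ### The Galois group of `ℚ(Γ_∞)` inside `A` -/

/-- The field `ℚ(Γ_∞)`, as a subfield of `ℂ`. -/
noncomputable abbrev radicalField (Γ : Subgroup ℚˣ) : IntermediateField ℚ ℂ :=
  IntermediateField.adjoin ℚ ((fun x : ℂˣ => (x : ℂ)) '' (radicalsInf Γ : Set ℂˣ))

/-- An element of `Γ_∞`, viewed as a unit of the field `ℚ(Γ_∞)`. -/
noncomputable def toFieldUnit (Γ : Subgroup ℚˣ) : radicalsInf Γ →* (radicalField Γ)ˣ where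
  toFun x := Units.mk0 ⟨((x : ℂˣ) : ℂ), IntermediateField.subset_adjoin _ _ ⟨x, x.2, rfl⟩⟩
    fun h => (x : ℂˣ).ne_zero (congrArg Subtype.val h)
  map_one' := by ext; simp
  map_mul' x y := by ext; simp

/-- The inclusion `ℚ(Γ_∞)ˣ → ℂˣ`. -/
noncomputable def fieldUnitVal (Γ : Subgroup ℚˣ) : (radicalField Γ)ˣ →* ℂˣ :=
  Units.map ((radicalField Γ).val : radicalField Γ →* ℂ)

theorem fieldUnitVal_toFieldUnit (Γ : Subgroup ℚˣ) (x : radicalsInf Γ) :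
    fieldUnitVal Γ (toFieldUnit Γ x) = x := by
  ext; rfl

theorem fieldUnitVal_injective (Γ : Subgroup ℚˣ) : Function.Injective (fieldUnitVal Γ) := by
  intro u v h
  ext
  exact congrArg (fun z : ℂˣ => (z : ℂ)) h

/-- The action of `σ ∈ Gal(ℚ(Γ_∞)/ℚ)` on the units of `ℚ(Γ_∞)`. -/
noncomputable def galUnit (Γ : Subgroup ℚˣ) (σ : Gal(radicalField Γ/ℚ)) :
    (radicalField Γ)ˣ →* (radicalField Γ)ˣ :=
  Units.map (σ : radicalField Γ →* radicalField Γ)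

theorem galUnit_of_range (Γ : Subgroup ℚˣ) (σ : Gal(radicalField Γ/ℚ)) {u : (radicalField Γ)ˣ}
    (hu : fieldUnitVal Γ u ∈ ratUnits.range) : galUnit Γ σ u = u := by
  obtain ⟨q, hq⟩ := hu
  have : u = Units.map (algebraMap ℚ (radicalField Γ) : ℚ →* radicalField Γ) q := by
    apply fieldUnitVal_injective
    rw [← hq]
    ext; rfl
  rw [this]
  ext
  simp [galUnit]

theorem galUnit_mem (Γ : Subgroup ℚˣ) (σ : Gal(radicalField Γ/ℚ)) (x : radicalsInf Γ) :
    fieldUnitVal Γ (galUnit Γ σ (toFieldUnit Γ x)) ∈ radicalsInf Γ := by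
  obtain ⟨n, hn, hx⟩ := x.2
  have h1 : fieldUnitVal Γ (toFieldUnit Γ x ^ n) = (x : ℂˣ) ^ n := by
    rw [map_pow, fieldUnitVal_toFieldUnit]
  refine ⟨n, hn, ?_⟩
  rw [← map_pow, ← map_pow, galUnit_of_range Γ σ (h1 ▸ map_le_range Γ hx), h1]
  exact hx

/-- The action of `σ ∈ Gal(ℚ(Γ_∞)/ℚ)` on `Γ_∞`, namely `x ↦ σ x`. -/
noncomputable def galAct (Γ : Subgroup ℚˣ) (σ : Gal(radicalField Γ/ℚ)) (x : radicalsInf Γ) :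
    radicalsInf Γ :=
  ⟨fieldUnitVal Γ (galUnit Γ σ (toFieldUnit Γ x)), galUnit_mem Γ σ x⟩

theorem toFieldUnit_galAct (Γ : Subgroup ℚˣ) (σ : Gal(radicalField Γ/ℚ)) (x : radicalsInf Γ) :
    toFieldUnit Γ (galAct Γ σ x) = galUnit Γ σ (toFieldUnit Γ x) := by
  apply fieldUnitVal_injective
  rw [fieldUnitVal_toFieldUnit]
  rfl

theorem galAct_mul (Γ : Subgroup ℚˣ) (σ τ : Gal(radicalField Γ/ℚ)) (x : radicalsInf Γ) :
    galAct Γ (σ * τ) x = galAct Γ σ (galAct Γ τ x) := by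
  apply Subtype.ext
  change fieldUnitVal Γ _ = fieldUnitVal Γ _
  rw [toFieldUnit_galAct]
  rfl

theorem galAct_one (Γ : Subgroup ℚˣ) (x : radicalsInf Γ) : galAct Γ 1 x = x := by
  apply Subtype.ext
  ext; rfl

/-- The Galois representation `Gal(ℚ(Γ_∞)/ℚ) → A`, which sends a field automorphism `σ` to its
restriction to `Γ_∞`. -/
noncomputable def galRep (Γ : Subgroup ℚˣ) : Gal(radicalField Γ/ℚ) →* autInf Γ where
  toFun σ :=
    ⟨{ toFun := galAct Γ σ
       invFun := galAct Γ σ⁻¹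
       left_inv := fun x => by rw [← galAct_mul, inv_mul_cancel, galAct_one]
       right_inv := fun x => by rw [← galAct_mul, mul_inv_cancel, galAct_one]
       map_mul' := fun x y => Subtype.ext (by simp [galAct]) }, by
      rw [mem_fixingSubgroup_iff]
      intro x hx
      apply Subtype.ext
      change fieldUnitVal Γ (galUnit Γ σ (toFieldUnit Γ x)) = x
      rw [galUnit_of_range Γ σ (by rw [fieldUnitVal_toFieldUnit]; exact hx),
        fieldUnitVal_toFieldUnit]⟩
  map_one' := Subtype.ext (MulEquiv.ext (galAct_one Γ))
  map_mul' σ τ := Subtype.ext (MulEquiv.ext (galAct_mul Γ σ τ))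

/-- The Galois group `G = Gal(ℚ(Γ_∞)/ℚ)`, viewed as a subgroup of `A` by its action on `Γ_∞`. -/
noncomputable abbrev galImage (Γ : Subgroup ℚˣ) : Subgroup (autInf Γ) := (galRep Γ).range

/-- The Galois representation is injective, so that `G` is indeed a copy of the Galois group. -/
theorem galRep_injective (Γ : Subgroup ℚˣ) : Function.Injective (galRep Γ) := by
  intro σ τ h
  have key : ((σ : radicalField Γ →ₐ[ℚ] radicalField Γ)) = τ := by
    refine IntermediateField.algHom_ext_of_eq_adjoin _ rfl ?_
    rintro _ ⟨x, hx, rfl⟩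
    have h1 : galAct Γ σ ⟨x, hx⟩ = galAct Γ τ ⟨x, hx⟩ :=
      congrArg (fun α : autInf Γ => (α : MulAut (radicalsInf Γ)) ⟨x, hx⟩) h
    have h2 := congrArg (toFieldUnit Γ) h1
    rw [toFieldUnit_galAct, toFieldUnit_galAct] at h2
    exact congrArg Units.val h2
  exact AlgEquiv.ext fun x => congrArg (fun f => f x) key

/-! ### Measures -/

/-- The Haar measure `ν_p` on the compact group `A_p`, normalized by `ν_p(A_p) = 1`. -/
noncomputable def haarPrim (Γ : Subgroup ℚˣ) (p : Nat.Primes) : Measure (autPrim Γ p) :=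
  Measure.haarMeasure ⊤

instance isProbabilityMeasure_haarPrim (Γ : Subgroup ℚˣ) (p : Nat.Primes) :
    IsProbabilityMeasure (haarPrim Γ p) :=
  ⟨Measure.haarMeasure_self (K₀ := (⊤ : TopologicalSpace.PositiveCompacts (autPrim Γ p)))⟩

/-- The measure `ν = ∏ p, ν_p` on `A ≃ ∏ p, A_p`. -/
noncomputable def haarInf (Γ : Subgroup ℚˣ) : Measure (autInf Γ) :=
  (Measure.infinitePi (haarPrim Γ)).map (autEquiv Γ).symm

theorem continuous_autEquiv (Γ : Subgroup ℚˣ) : Continuous (autEquiv Γ) := by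
  refine continuous_pi fun p => continuous_induced_rng.2 (continuous_mulAut fun x y => ?_)
  have : {α : autInf Γ | ((autEquiv Γ α p : MulAut (radicalsPrim Γ p)) x) = y} =
      Subtype.val ⁻¹' {β : MulAut (radicalsInf Γ) |
        β ⟨x, radicals_mono Γ (powers_le p) x.2⟩ = ⟨y, radicals_mono Γ (powers_le p) y.2⟩} := by
    ext α
    change (autRes Γ α p : MulAut (radicalsPrim Γ p)) x = y ↔ (α : MulAut (radicalsInf Γ)) _ = _
    rw [Subtype.ext_iff, Subtype.ext_iff, autRes_apply]
  change IsOpen {α : autInf Γ | ((autEquiv Γ α p : MulAut (radicalsPrim Γ p)) x) = y}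
  rw [this]
  exact (isOpen_apply_eq _ _).preimage continuous_subtype_val

theorem continuous_autEquiv_symm (Γ : Subgroup ℚˣ) : Continuous (autEquiv Γ).symm :=
  (Continuous.homeoOfEquivCompactToT2 (f := (autEquiv Γ).toEquiv)
    (continuous_autEquiv Γ)).symm.continuous

instance secondCountable_autInf (Γ : Subgroup ℚˣ) : SecondCountableTopology (autInf Γ) := by
  have := countable_radicals Γ (M := nonZeroDivisors ℕ) (by simp)
  have := secondCountable_mulAut (radicalsInf Γ)
  exact TopologicalSpace.Subtype.secondCountableTopology (autInf Γ : Set (MulAut (radicalsInf Γ)))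

instance secondCountable_autPrim (Γ : Subgroup ℚˣ) (p : Nat.Primes) :
    SecondCountableTopology (autPrim Γ p) := by
  have := countable_radicals Γ (zero_notMem_powers p)
  have := secondCountable_mulAut (radicalsPrim Γ p)
  exact TopologicalSpace.Subtype.secondCountableTopology (autPrim Γ p : Set (MulAut (radicalsPrim Γ p)))

theorem measurable_autEquiv_symm (Γ : Subgroup ℚˣ) : Measurable (autEquiv Γ).symm :=
  (continuous_autEquiv_symm Γ).measurable

instance isProbabilityMeasure_haarInf (Γ : Subgroup ℚˣ) : IsProbabilityMeasure (haarInf Γ) :=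
  Measure.isProbabilityMeasure_map (measurable_autEquiv_symm Γ).aemeasurable

/-- The product measure `ν` is the normalized Haar measure on the compact group `A`. -/
theorem haarInf_eq_haarMeasure (Γ : Subgroup ℚˣ) : haarInf Γ = Measure.haarMeasure ⊤ := by
  have hinv : (haarInf Γ).IsMulLeftInvariant := by
    refine ⟨fun g => ?_⟩
    have h1 : (Measure.infinitePi (haarPrim Γ)).map (fun x p => autEquiv Γ g p * x p) =
        Measure.infinitePi (haarPrim Γ) := by
      have h2 : ∀ p, (haarPrim Γ p).IsMulLeftInvariant := fun p =>
        inferInstanceAs (Measure.haarMeasure _).IsMulLeftInvariant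
      rw [Measure.infinitePi_map_pi (f := fun p x => autEquiv Γ g p * x) _
        fun p => measurable_const_mul _]
      congr 1
      funext p
      exact map_mul_left_eq_self (haarPrim Γ p) _
    have hm : Measurable fun (x : ∀ p : Nat.Primes, autPrim Γ p) p => autEquiv Γ g p * x p :=
      measurable_pi_lambda _ fun p => (measurable_const_mul _).comp (measurable_pi_apply p)
    conv_rhs => rw [haarInf, ← h1]
    rw [haarInf, Measure.map_map (measurable_const_mul g) (measurable_autEquiv_symm Γ),
      Measure.map_map (measurable_autEquiv_symm Γ) hm]
    congr 1
    funext x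
    apply (autEquiv Γ).injective
    simp only [Function.comp, map_mul, MulEquiv.apply_symm_apply]
    rfl
  have h := Measure.haarMeasure_unique (haarInf Γ) ⊤
  have h1 : haarInf Γ ((⊤ : TopologicalSpace.PositiveCompacts (autInf Γ)) : Set (autInf Γ)) = 1 :=
    measure_univ
  rwa [h1, one_smul] at h

/-- The subset of `A` that corresponds to `∏ p, S_p` under `A ≃ ∏ p, A_p`. -/
def prodSet (Γ : Subgroup ℚˣ) (S : ∀ p : Nat.Primes, Set (autPrim Γ p)) : Set (autInf Γ) :=
  {α | ∀ p, autEquiv Γ α p ∈ S p}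

/-! ### Characters and the correction factor -/

/-- The `p`-primary component `χ_p : A_p → {±1}` of a character `χ : A → {±1}`: the restriction
of `χ` to the factor `A_p` of `A ≃ ∏ p, A_p`. -/
noncomputable def primaryPart {Γ : Subgroup ℚˣ} (χ : autInf Γ →* ℤˣ) (p : Nat.Primes) :
    autPrim Γ p →* ℤˣ :=
  (χ.comp (autEquiv Γ).symm.toMonoidHom).comp (MonoidHom.mulSingle (fun q => autPrim Γ q) p)

/-- `E_{χ,p}`, the average value of `χ_p` on `S_p`. -/
noncomputable def localFactor {Γ : Subgroup ℚˣ} (S : ∀ p : Nat.Primes, Set (autPrim Γ p))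
    (χ : autInf Γ →* ℤˣ) (p : Nat.Primes) : ℝ :=
  ((haarPrim Γ p).real (S p))⁻¹ * ∫ a in S p, ((primaryPart χ p a : ℤ) : ℝ) ∂(haarPrim Γ p)

/-- `E_χ = ∏ p, E_{χ,p}`; all but finitely many factors are `1` when all but finitely many of the
`χ_p` are trivial. -/
noncomputable def characterFactor {Γ : Subgroup ℚˣ} (S : ∀ p : Nat.Primes, Set (autPrim Γ p))
    (χ : autInf Γ →* ℤˣ) : ℝ :=
  ∏ᶠ p, localFactor S χ p

/-- The density `δ(S) = ν(G ∩ S) / ν(G)` inside `G` of a subset `S` of `A`. -/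
noncomputable def galDensity (Γ : Subgroup ℚˣ) (S : Set (autInf Γ)) : ℝ :=
  (haarInf Γ).real ((galImage Γ : Set (autInf Γ)) ∩ S) /
    (haarInf Γ).real (galImage Γ : Set (autInf Γ))

/-- The naive density `ν(S) / ν(A)`. -/
noncomputable def naiveDensity (Γ : Subgroup ℚˣ) (S : Set (autInf Γ)) : ℝ :=
  (haarInf Γ).real S / (haarInf Γ).real Set.univ

/-!
The theorem holds because `G` is an open normal subgroup of `A` with elementary abelian `2`-group
quotient. The indicator function of `G` is then `|X|⁻¹ ∑ χ` by orthogonality of characters, and each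
`χ` is continuous, hence a finite product of characters of the factors `A_p`, so that its integral
over a product set factors over the primes.

Structure of `A / G`. An automorphism `α ∈ A` comes from the Galois group exactly if it preserves
the `ℚ`-linear relations between elements of `Γ_∞` (`mem_galImage_iff_relations`). This condition is
closed, so no topology on the Galois group is needed. Irreducibility of the cyclotomic polynomials
shows that `G` realizes every action on roots of unity (`exists_mem_galImage_eq_on_torsion`), so each
coset of `G` has a representative that fixes all roots of unity. If `α` fixes all roots of unity and
all square roots of rational numbers in `Γ_∞`, then `α ∈ G` (`mem_galImage_of_eq_on_sqrt`). Indeed,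
Dedekind's independence of characters, applied to the Kummer characters over the maximal cyclotomic
field, reduces this to the elements of `Γ_∞` inside that field. For such an element `x`
the Galois action commutes with complex conjugation, so `|x| ^ 2` is rational; since `x` divided by
its conjugate is a root of unity, `x` is a root of unity times a square root of a rational number
(`exists_torsion_mul_sqrt`). As `A` acts on square roots of rationals by signs,
automorphisms that fix roots of unity are central and of order at most two modulo `G`; hence `G` is
normal and `A / G` has exponent two. It is finite since a finitely generated `Γ` involves
finitely many square classes.

Integration. Over the infinite product, the integral of finitely many coordinate functions on a
product set is the limit of finite partial products
(`setIntegral_infinitePi_eq_prod_average_mul`). Stated as a product of averages times the measure of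
the set, the formula needs no convergence hypothesis and covers product sets of measure zero. The
normalization `|X| ν(G) = 1` comes from the vanishing of `∫ χ` for nontrivial `χ`
(`card_mul_measure_galImage`).
-/

/-! ### The field `ℚ(Γ_∞)` -/

theorem isAlgebraic_of_mem_radicalsInf {Γ : Subgroup ℚˣ} {x : ℂˣ} (hx : x ∈ radicalsInf Γ) :
    IsAlgebraic ℚ (x : ℂ) := by
  obtain ⟨n, hn, q, -, hq⟩ := hx
  refine IsAlgebraic.of_pow (n := n) (Nat.pos_of_ne_zero (by simpa using hn)) ?_
  rw [← Units.val_pow_eq_pow_val, ← hq]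
  exact isAlgebraic_algebraMap (q : ℚ)

theorem mem_radicalField {Γ : Subgroup ℚˣ} {x : ℂˣ} (hx : x ∈ radicalsInf Γ) :
    (x : ℂ) ∈ radicalField Γ :=
  IntermediateField.subset_adjoin _ _ ⟨x, hx, rfl⟩

theorem isAlgebraic_radicalField (Γ : Subgroup ℚˣ) : Algebra.IsAlgebraic ℚ (radicalField Γ) := by
  refine IntermediateField.isAlgebraic_adjoin ?_
  rintro _ ⟨x, hx, rfl⟩
  exact (isAlgebraic_of_mem_radicalsInf hx).isIntegral

/-- `ℚ(Γ_∞)` is generated by all roots of the polynomials `X ^ n - a` with `a ∈ Γ`. -/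
instance isGalois_radicalField (Γ : Subgroup ℚˣ) : IsGalois ℚ (radicalField Γ) := by
  have := isAlgebraic_radicalField Γ
  have : Normal ℚ (radicalField Γ) := by
    refine normal_iff.2 fun x => ⟨Algebra.IsIntegral.isIntegral x, ?_⟩
    rw [← minpoly.algHom_eq (radicalField Γ).val.toRingHom.toRatAlgHom (RingHom.injective _) x]
    refine IntermediateField.splits_of_mem_adjoin
      (S := (fun x : ℂˣ => (x : ℂ)) '' (radicalsInf Γ : Set ℂˣ)) (splits := ?_) (hx := x.2)
    rintro _ ⟨y, hy, rfl⟩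
    refine ⟨(isAlgebraic_of_mem_radicalsInf hy).isIntegral,
      IntermediateField.splits_of_splits (IsAlgClosed.splits _) fun z hz => ?_⟩
    obtain ⟨n, hn, q, hq, hqy⟩ := hy
    have hz0 := Polynomial.aeval_eq_zero_of_mem_rootSet hz
    have hn0 : n ≠ 0 := by simpa using hn
    have hdvd : minpoly ℚ (y : ℂ) ∣ Polynomial.X ^ n - Polynomial.C (q : ℚ) := by
      refine minpoly.dvd _ _ ?_
      rw [map_sub, map_pow, Polynomial.aeval_X, Polynomial.aeval_C, sub_eq_zero,
        ← Units.val_pow_eq_pow_val, ← hqy]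
      rfl
    obtain ⟨P, hP⟩ := hdvd
    have hzq : z ^ n = ((ratUnits q : ℂˣ) : ℂ) := by
      have := congrArg (Polynomial.aeval z) hP
      rw [map_mul, hz0, zero_mul, map_sub, map_pow, Polynomial.aeval_X, Polynomial.aeval_C,
        sub_eq_zero] at this
      exact this
    have hz' : z ≠ 0 := by
      rintro rfl
      rw [zero_pow hn0] at hzq
      exact (ratUnits q).ne_zero hzq.symm
    refine mem_radicalField (x := Units.mk0 z hz') ⟨n, hn, q, hq, Units.ext ?_⟩
    simp [hzq]
  exact ⟨⟩

/-- Two multiplicative maps `ι` and `β` from a group `M` to a normal algebraic extension `E` of `F`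
are conjugate under `Gal(E/F)` as soon as every `F`-linear relation between the values of `ι` also
holds between the values of `β`: the rule `ι m ↦ β m` then defines an embedding of the subfield
generated by `ι M`, which is spanned by `ι M`. -/
theorem exists_gal_of_relations {F E M : Type*} [Field F] [Field E] [Algebra F E] [Normal F E]
    [CommGroup M] (ι β : M →* E)
    (h : ∀ f : M →₀ F, Finsupp.linearCombination F ι f = 0 → Finsupp.linearCombination F β f = 0) :
    ∃ σ : Gal(E/F), ∀ m, σ (ι m) = β m := by
  set φ := MonoidAlgebra.lift F E M ι with hφ
  set ψ := MonoidAlgebra.lift F E M β with hψ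
  have hker : ∀ f ∈ RingHom.ker φ.rangeRestrict, ψ f = 0 := by
    intro f hf
    replace hf : φ f = 0 := congrArg Subtype.val hf
    rw [hφ, MonoidAlgebra.lift_apply] at hf
    rw [hψ, MonoidAlgebra.lift_apply]
    exact h f.coeff hf
  let K : IntermediateField F E :=
    Subalgebra.IsAlgebraic.toIntermediateField (S := φ.range)
      (fun x _ => Algebra.IsAlgebraic.isAlgebraic x)
  let τ₀ : φ.range →ₐ[F] E := (Ideal.Quotient.liftₐ (RingHom.ker φ.rangeRestrict) ψ hker).comp
    ((Ideal.quotientKerAlgEquivOfSurjective φ.rangeRestrict_surjective).symm :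
      φ.range →ₐ[F] MonoidAlgebra F M ⧸ RingHom.ker φ.rangeRestrict)
  have hτ₀ : ∀ f, τ₀ (φ.rangeRestrict f) = ψ f := by
    intro f
    have : (Ideal.quotientKerAlgEquivOfSurjective φ.rangeRestrict_surjective).symm
        (φ.rangeRestrict f) = Ideal.Quotient.mk _ f := by
      rw [AlgEquiv.symm_apply_eq]
      rfl
    change Ideal.Quotient.liftₐ _ ψ hker
      ((Ideal.quotientKerAlgEquivOfSurjective φ.rangeRestrict_surjective).symm
        (φ.rangeRestrict f)) = _
    rw [this]
    rfl
  obtain ⟨τ, hτ⟩ := IntermediateField.exists_algHom_of_splits (K := E) (L := K)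
    (Normal.out (F := F) (K := E) inferInstance) (τ₀ : K →ₐ[F] E)
  refine ⟨AlgEquiv.ofBijective τ (AlgHom.normal_bijective F E E τ), fun m => ?_⟩
  have h1 : φ (MonoidAlgebra.of F M m) = ι m := by rw [hφ, MonoidAlgebra.lift_of]
  have h2 : ψ (MonoidAlgebra.of F M m) = β m := by rw [hψ, MonoidAlgebra.lift_of]
  have h3 := DFunLike.congr_fun hτ (φ.rangeRestrict (MonoidAlgebra.of F M m) : K)
  rw [← h2, ← hτ₀]
  rw [← h1]
  exact h3

/-! ### The Galois group as a closed subgroup of `A` -/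

/-- The inclusion of `Γ_∞` into the multiplicative monoid of `ℚ(Γ_∞)`. -/
noncomputable def radicalToField (Γ : Subgroup ℚˣ) : radicalsInf Γ →* radicalField Γ :=
  (Units.coeHom _).comp (toFieldUnit Γ)

theorem coe_radicalToField (Γ : Subgroup ℚˣ) (x : radicalsInf Γ) :
    (radicalToField Γ x : ℂ) = ((x : ℂˣ) : ℂ) := rfl

theorem radicalToField_injective (Γ : Subgroup ℚˣ) : Function.Injective (radicalToField Γ) :=
  fun _ _ h => Subtype.ext (Units.ext (congrArg Subtype.val h))

theorem radicalToField_ne_zero (Γ : Subgroup ℚˣ) (x : radicalsInf Γ) : radicalToField Γ x ≠ 0 :=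
  (toFieldUnit Γ x).ne_zero

theorem radicalToField_galRep (Γ : Subgroup ℚˣ) (σ : Gal(radicalField Γ/ℚ)) (x : radicalsInf Γ) :
    radicalToField Γ ((galRep Γ σ : MulAut (radicalsInf Γ)) x) = σ (radicalToField Γ x) :=
  congrArg Units.val (toFieldUnit_galAct Γ σ x)

theorem mem_galImage_iff {Γ : Subgroup ℚˣ} {α : autInf Γ} :
    α ∈ galImage Γ ↔ ∃ σ : Gal(radicalField Γ/ℚ), ∀ x,
      σ (radicalToField Γ x) = radicalToField Γ ((α : MulAut (radicalsInf Γ)) x) := by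
  constructor
  · rintro ⟨σ, rfl⟩
    exact ⟨σ, fun x => (radicalToField_galRep Γ σ x).symm⟩
  · rintro ⟨σ, h⟩
    refine ⟨σ, Subtype.ext (MulEquiv.ext fun x => radicalToField_injective Γ ?_)⟩
    rw [radicalToField_galRep, h]

/-- An automorphism of `Γ_∞` comes from the Galois group if and only if it preserves all
`ℚ`-linear relations between elements of `Γ_∞`. -/
theorem mem_galImage_iff_relations {Γ : Subgroup ℚˣ} {α : autInf Γ} :
    α ∈ galImage Γ ↔ ∀ f : radicalsInf Γ →₀ ℚ,
      Finsupp.linearCombination ℚ (radicalToField Γ) f = 0 →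
      Finsupp.linearCombination ℚ
        (fun x => radicalToField Γ ((α : MulAut (radicalsInf Γ)) x)) f = 0 := by
  rw [mem_galImage_iff]
  constructor
  · rintro ⟨σ, h⟩ f hf
    have := congrArg σ hf
    rw [map_zero, Finsupp.linearCombination_apply, Finsupp.sum, map_sum] at this
    simpa [Finsupp.linearCombination_apply, Finsupp.sum, ← h, map_rat_smul] using this
  · exact exists_gal_of_relations (radicalToField Γ)
      ((radicalToField Γ).comp (MulEquiv.toMonoidHom (α : MulAut (radicalsInf Γ))))

/-- Each single relation involves only finitely many values of `α`, so it is preserved on a clopen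
set of automorphisms `α`. -/
theorem isClosed_galImage (Γ : Subgroup ℚˣ) : IsClosed (galImage Γ : Set (autInf Γ)) := by
  have : (galImage Γ : Set (autInf Γ)) = ⋂ (f : radicalsInf Γ →₀ ℚ)
      (_ : Finsupp.linearCombination ℚ (radicalToField Γ) f = 0), {α : autInf Γ |
        Finsupp.linearCombination ℚ
          (fun x => radicalToField Γ ((α : MulAut (radicalsInf Γ)) x)) f = 0} := by
    ext α
    simp only [SetLike.mem_coe, Set.mem_iInter]
    exact mem_galImage_iff_relations
  rw [this]
  refine isClosed_iInter fun f => isClosed_iInter fun _ => ⟨isOpen_iff_mem_nhds.2 fun α hα => ?_⟩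
  have hU : (⋂ x ∈ f.support, {β : autInf Γ |
      (β : MulAut (radicalsInf Γ)) x = (α : MulAut (radicalsInf Γ)) x}) ∈ 𝓝 α :=
    (Filter.biInter_finset_mem _).2 fun x _ =>
      ((isOpen_apply_eq x _).preimage continuous_subtype_val).mem_nhds rfl
  filter_upwards [hU] with β hβ h0
  refine hα (h0 ▸ ?_)
  refine Finset.sum_congr rfl fun x hx => ?_
  have hβx : (β : MulAut (radicalsInf Γ)) x = (α : MulAut (radicalsInf Γ)) x :=
    Set.mem_iInter₂.1 hβ x hx
  simp only [hβx]

theorem mem_radicalsInf_of_pow_eq_one (Γ : Subgroup ℚˣ) {x : ℂˣ} {n : ℕ} (hn : n ≠ 0)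
    (hx : x ^ n = 1) : x ∈ radicalsInf Γ :=
  ⟨n, by simpa using hn, hx ▸ one_mem _⟩

/-- The Galois group realizes every action on roots of unity, since the cyclotomic polynomials are
irreducible over `ℚ`. -/
theorem exists_mem_galImage_eq_on_torsion {Γ : Subgroup ℚˣ} (α : autInf Γ) :
    ∃ g ∈ galImage Γ, ∀ ζ : radicalsInf Γ, IsOfFinOrder ζ →
      (g : MulAut (radicalsInf Γ)) ζ = (α : MulAut (radicalsInf Γ)) ζ := by
  set ι := (radicalToField Γ).comp (CommGroup.torsion (radicalsInf Γ)).subtype with hι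
  set β := ((radicalToField Γ).comp (MulEquiv.toMonoidHom (α : MulAut (radicalsInf Γ)))).comp
    (CommGroup.torsion (radicalsInf Γ)).subtype with hβ
  suffices h : ∀ f : CommGroup.torsion (radicalsInf Γ) →₀ ℚ,
      Finsupp.linearCombination ℚ ι f = 0 → Finsupp.linearCombination ℚ β f = 0 by
    obtain ⟨σ, hσ⟩ := exists_gal_of_relations ι β h
    refine ⟨galRep Γ σ, ⟨σ, rfl⟩, fun ζ hζ => radicalToField_injective Γ ?_⟩
    rw [radicalToField_galRep]
    exact hσ ⟨ζ, hζ⟩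
  intro f hf
  set n := ∏ m ∈ f.support, orderOf m with hn
  have hn0 : n ≠ 0 := by
    refine Finset.prod_ne_zero_iff.2 fun m _ => ?_
    rw [← Subgroup.orderOf_coe]
    exact (IsOfFinOrder.orderOf_pos m.2).ne'
  obtain ⟨w, hw⟩ : ∃ w : radicalsInf Γ, IsPrimitiveRoot w n := by
    have h := (Complex.isPrimitiveRoot_exp n hn0)
    have h' : IsPrimitiveRoot (h.isUnit hn0).unit n := IsPrimitiveRoot.coe_units_iff.1 h
    exact ⟨⟨_, mem_radicalsInf_of_pow_eq_one Γ hn0 h'.pow_eq_one⟩,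
      IsPrimitiveRoot.coe_submonoidClass_iff.1 h'⟩
  have : NeZero n := ⟨hn0⟩
  have hv := hw.map_of_injective (radicalToField_injective Γ)
  have hv' := (hw.map_of_injective (α : MulAut (radicalsInf Γ)).injective).map_of_injective
    (radicalToField_injective Γ)
  have hpow : ∀ m ∈ f.support, ∃ i : ℕ, (m : radicalsInf Γ) = w ^ i := by
    intro m hm
    have h1 : m ^ n = 1 := orderOf_dvd_iff_pow_eq_one.1 (Finset.dvd_prod_of_mem _ hm)
    have h2 : (m : radicalsInf Γ) ^ n = 1 := congrArg Subtype.val h1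
    obtain ⟨i, -, hi⟩ := hv.eq_pow_of_pow_eq_one (ξ := radicalToField Γ m)
      (by rw [← map_pow, h2, map_one])
    exact ⟨i, radicalToField_injective Γ (by rw [map_pow, hi])⟩
  choose! i hi using hpow
  -- The relation `f` says that `w` is a root of `P`, and then so is its Galois conjugate `α w`.
  let P : Polynomial ℚ := ∑ m ∈ f.support, Polynomial.C (f m) * Polynomial.X ^ i m
  have hP : Polynomial.aeval (radicalToField Γ w) P = 0 := by
    rw [← hf, Finsupp.linearCombination_apply, Finsupp.sum, map_sum]
    refine Finset.sum_congr rfl fun m hm => ?_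
    simp [hι, hi m hm, Algebra.smul_def]
  have hdvd := minpoly.dvd ℚ _ hP
  rw [← Polynomial.cyclotomic_eq_minpoly_rat hv (Nat.pos_of_ne_zero hn0),
    Polynomial.cyclotomic_eq_minpoly_rat hv' (Nat.pos_of_ne_zero hn0)] at hdvd
  have hP' := (Polynomial.aeval_eq_zero_of_dvd_aeval_eq_zero hdvd (minpoly.aeval _ _))
  rw [← hP', Finsupp.linearCombination_apply, Finsupp.sum, map_sum]
  refine Finset.sum_congr rfl fun m hm => ?_
  simp [hβ, hi m hm, Algebra.smul_def]

/-! ### Radicals in the maximal cyclotomic field -/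

theorem Complex.conj_eq_inv_of_pow_eq_one {z : ℂ} {n : ℕ} (hn : n ≠ 0) (h : z ^ n = 1) :
    (starRingEnd ℂ) z = z⁻¹ :=
  (Complex.inv_eq_conj (Complex.norm_eq_one_of_pow_eq_one h hn)).symm

/-- The automorphisms of a field that fix all roots of unity. -/
def fixingRootsOfUnity (E : Type*) [Field E] [CharZero E] : Subgroup Gal(E/ℚ) where
  carrier := {σ | ∀ (ζ : E) (n : ℕ), n ≠ 0 → ζ ^ n = 1 → σ ζ = ζ}
  one_mem' := fun _ _ _ _ => rfl
  mul_mem' := by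
    intro σ τ hσ hτ ζ n hn h
    rw [AlgEquiv.mul_apply, hτ ζ n hn h, hσ ζ n hn h]
  inv_mem' := by
    intro σ hσ ζ n hn h
    exact (AlgEquiv.symm_apply_eq σ).2 (hσ ζ n hn h).symm

/-- Complex conjugation restricts to the normal field `ℚ(Γ_∞)`. -/
theorem exists_gal_conj (Γ : Subgroup ℚˣ) : ∃ c : Gal(radicalField Γ/ℚ), ∀ z : radicalField Γ,
    (c z : ℂ) = (starRingEnd ℂ) z :=
  ⟨((Complex.conjAe : ℂ →+* ℂ).toRatAlgHom.restrictNormal' (radicalField Γ)), fun z =>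
    AlgHom.restrictNormal_commutes (Complex.conjAe : ℂ →+* ℂ).toRatAlgHom (radicalField Γ) z⟩

theorem pow_mem_range_of_radicalsInf {Γ : Subgroup ℚˣ} (x : radicalsInf Γ) :
    ∃ n ≠ 0, ∃ q : ℚ, radicalToField Γ x ^ n = algebraMap ℚ (radicalField Γ) q := by
  obtain ⟨n, hn, q, -, hq⟩ := x.2
  refine ⟨n, by simpa using hn, q, Subtype.ext ?_⟩
  have := congrArg (fun z : ℂˣ => (z : ℂ)) hq
  simp only [Units.val_pow_eq_pow_val] at this
  simp only [SubmonoidClass.coe_pow, coe_radicalToField, ← this]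
  rfl

/-- If `x ∈ Γ_∞` lies in the maximal cyclotomic field, which has an abelian Galois group, then the
action of the Galois group on `x` commutes with complex conjugation. Hence the automorphisms
multiply `x` and its conjugate by mutually inverse roots of unity and fix `|x| ^ 2`. -/
theorem exists_mul_conj_eq_rat {Γ : Subgroup ℚˣ} (x : radicalsInf Γ)
    (hx : ∀ σ ∈ fixingRootsOfUnity (radicalField Γ), σ (radicalToField Γ x) = radicalToField Γ x) :
    ∃ q : ℚ, ((x : ℂˣ) : ℂ) * (starRingEnd ℂ) ((x : ℂˣ) : ℂ) = q := by
  obtain ⟨c, hc⟩ := exists_gal_conj Γ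
  set u := radicalToField Γ x with hu
  have hu0 : u ≠ 0 := radicalToField_ne_zero Γ x
  have hcζ : ∀ (ζ : radicalField Γ) (n : ℕ), n ≠ 0 → ζ ^ n = 1 → c ζ = ζ⁻¹ := by
    intro ζ n hn h
    refine Subtype.ext ?_
    rw [hc]
    exact Complex.conj_eq_inv_of_pow_eq_one hn (by simpa using congrArg Subtype.val h)
  obtain ⟨n, hn, q, hq⟩ := pow_mem_range_of_radicalsInf x
  have hfix : ∀ σ : Gal(radicalField Γ/ℚ), σ (u * c u) = u * c u := by
    intro σ
    have hcomm : (σ * c)⁻¹ * (c * σ) ∈ fixingRootsOfUnity (radicalField Γ) := by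
      intro ζ k hk h
      have h1 : c (σ ζ) = σ (c ζ) := by
        rw [hcζ ζ k hk h, hcζ (σ ζ) k hk (by rw [← map_pow, h, map_one]), map_inv₀]
      rw [AlgEquiv.mul_apply, AlgEquiv.mul_apply, h1]
      exact AlgEquiv.symm_apply_apply (σ * c) ζ
    have h1 := congrArg (σ * c) (hx _ hcomm)
    rw [← AlgEquiv.mul_apply, mul_inv_cancel_left, AlgEquiv.mul_apply, AlgEquiv.mul_apply] at h1
    have h2 : (σ u / u) ^ n = 1 := by
      rw [div_pow, ← map_pow, hq, AlgEquiv.commutes, div_self]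
      rw [← hq]
      exact pow_ne_zero _ hu0
    have h3 := hcζ _ n hn h2
    have h4 : σ u ≠ 0 := by simpa using hu0
    rw [map_div₀, h1, inv_div, div_eq_div_iff (by simpa using hu0) h4] at h3
    rw [map_mul, mul_comm, h3]
  obtain ⟨r, hr⟩ := (InfiniteGalois.mem_range_algebraMap_iff_fixed (u * c u)).2 hfix
  refine ⟨r, ?_⟩
  have := congrArg Subtype.val hr
  rw [MulMemClass.coe_mul, hc, hu, coe_radicalToField] at this
  rw [← this]
  rfl

/-- An element of `Γ_∞` in the maximal cyclotomic field is, up to a root of unity, a square root of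
a rational number. -/
theorem exists_torsion_mul_sqrt {Γ : Subgroup ℚˣ} (x : radicalsInf Γ)
    (hx : ∀ σ ∈ fixingRootsOfUnity (radicalField Γ), σ (radicalToField Γ x) = radicalToField Γ x) :
    ∃ η y : radicalsInf Γ, IsOfFinOrder η ∧ ((y : ℂˣ) ^ 2) ∈ ratUnits.range ∧ x = η * y := by
  obtain ⟨q, hq⟩ := exists_mul_conj_eq_rat x hx
  obtain ⟨n, hn, r, hr⟩ := pow_mem_range_of_radicalsInf x
  replace hr := congrArg Subtype.val hr
  rw [SubmonoidClass.coe_pow, coe_radicalToField] at hr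
  set z : ℂ := ((x : ℂˣ) : ℂ) with hz
  have hz0 : z ≠ 0 := (x : ℂˣ).ne_zero
  have hz1 : (starRingEnd ℂ) z ≠ 0 := by simpa using hz0
  obtain ⟨w, hw⟩ := IsAlgClosed.exists_pow_nat_eq (z / (starRingEnd ℂ) z) (n := 2) two_pos
  have hw0 : w ≠ 0 := by
    rintro rfl
    exact div_ne_zero hz0 hz1 (by simpa using hw.symm)
  have hwn : w ^ (2 * n) = 1 := by
    rw [pow_mul, hw, div_pow, ← map_pow, hr]
    have : (starRingEnd ℂ) ((algebraMap ℚ (radicalField Γ) r : radicalField Γ) : ℂ) =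
      ((algebraMap ℚ (radicalField Γ) r : radicalField Γ) : ℂ) := by
      change (starRingEnd ℂ) (((r : radicalField Γ)) : ℂ) = ((r : radicalField Γ) : ℂ)
      simp
    rw [this, div_self]
    rw [← hr]
    exact pow_ne_zero _ hz0
  have hwn' : (Units.mk0 w hw0) ^ (2 * n) = 1 := Units.ext (by simpa using hwn)
  have h2n : 2 * n ≠ 0 := by positivity
  let η : radicalsInf Γ := ⟨Units.mk0 w hw0, mem_radicalsInf_of_pow_eq_one Γ h2n hwn'⟩
  refine ⟨η, η⁻¹ * x, ?_, ?_, (mul_inv_cancel_left _ _).symm⟩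
  · exact isOfFinOrder_iff_pow_eq_one.2 ⟨2 * n, Nat.pos_of_ne_zero h2n, Subtype.ext hwn'⟩
  · have hq0 : q ≠ 0 := by
      rintro rfl
      simp [hz0] at hq
    refine ⟨Units.mk0 q hq0, Units.ext ?_⟩
    change (algebraMap ℚ ℂ q : ℂ) = (w⁻¹ * z) ^ 2
    rw [mul_pow, inv_pow, hw, eq_ratCast, ← hq]
    field_simp

/-! ### Kummer theory over the maximal cyclotomic field -/

/-- The Kummer character `σ ↦ σ x / x` of the automorphisms that fix all roots of unity. -/
noncomputable def kummerChar {Γ : Subgroup ℚˣ} (x : radicalsInf Γ) :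
    fixingRootsOfUnity (radicalField Γ) →* radicalField Γ where
  toFun σ := (σ : Gal(radicalField Γ/ℚ)) (radicalToField Γ x) / radicalToField Γ x
  map_one' := div_self (radicalToField_ne_zero Γ x)
  map_mul' σ τ := by
    have hu := radicalToField_ne_zero Γ x
    obtain ⟨n, hn, q, hq⟩ := pow_mem_range_of_radicalsInf x
    have h := σ.2 ((τ : Gal(radicalField Γ/ℚ)) (radicalToField Γ x) / radicalToField Γ x) n hn (by
      rw [div_pow, ← map_pow, hq, AlgEquiv.commutes, div_self]
      rw [← hq]
      exact pow_ne_zero _ hu)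
    rw [map_div₀, div_eq_iff (by simpa using hu)] at h
    rw [Subgroup.coe_mul, AlgEquiv.mul_apply, h]
    field_simp

theorem kummerChar_apply {Γ : Subgroup ℚˣ} (x : radicalsInf Γ)
    (σ : fixingRootsOfUnity (radicalField Γ)) : kummerChar x σ =
      (σ : Gal(radicalField Γ/ℚ)) (radicalToField Γ x) / radicalToField Γ x := rfl

/-- Kummer theory over the maximal cyclotomic field. Elements of `Γ_∞` with distinct Kummer
characters are linearly independent over that field, by Dedekind's theorem; so an automorphism that
multiplies elements with the same Kummer character by the same factor preserves all relations. -/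
theorem mem_galImage_of_eq_on_sqrt {Γ : Subgroup ℚˣ} {α : autInf Γ}
    (h1 : ∀ ζ : radicalsInf Γ, IsOfFinOrder ζ → (α : MulAut (radicalsInf Γ)) ζ = ζ)
    (h2 : ∀ y : radicalsInf Γ, (y : ℂˣ) ^ 2 ∈ ratUnits.range →
      (α : MulAut (radicalsInf Γ)) y = y) : α ∈ galImage Γ := by
  set u := radicalToField Γ with hu
  set A : MulAut (radicalsInf Γ) := (α : MulAut (radicalsInf Γ)) with hA
  have hu0 : ∀ x, u x ≠ 0 := radicalToField_ne_zero Γ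
  rw [mem_galImage_iff_relations]
  intro f hf
  -- the multiplier of `α` at `x` depends only on the Kummer character of `x`
  have hfac : Function.FactorsThrough (fun x : radicalsInf Γ => u (A x) / u x) kummerChar := by
    intro x y hxy
    obtain ⟨η, z, hη, hz, hxyz⟩ := exists_torsion_mul_sqrt (x * y⁻¹) (fun σ hσ => by
      have := DFunLike.congr_fun hxy ⟨σ, hσ⟩
      rw [kummerChar_apply, kummerChar_apply, div_eq_div_iff (hu0 x) (hu0 y)] at this
      have hinv : u y⁻¹ = (u y)⁻¹ := eq_inv_of_mul_eq_one_left (by rw [← map_mul]; simp)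
      have hσy : σ (u y) ≠ 0 := by simpa using hu0 y
      have := hu0 y
      simp only [map_mul, ← hu, hinv, map_inv₀]
      field_simp
      linear_combination ‹σ (u x) * u y = _›)
    have hfix : A (x * y⁻¹) = x * y⁻¹ := by rw [hxyz, map_mul, h1 η hη, h2 z hz]
    rw [map_mul, map_inv, mul_inv_eq_iff_eq_mul] at hfix
    have hAx : u (A x) * u y = u (A y) * u x := by
      rw [← map_mul, ← map_mul, hfix]
      congr 1
      rw [mul_right_comm, inv_mul_cancel_right, mul_comm]
    simp only
    rw [div_eq_div_iff (hu0 x) (hu0 y), hAx]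
  let c : (fixingRootsOfUnity (radicalField Γ) →* radicalField Γ) → radicalField Γ :=
    Function.extend kummerChar (fun x : radicalsInf Γ => u (A x) / u x) 0
  have hc : ∀ x, c (kummerChar x) = u (A x) / u x := fun x => hfac.extend_apply 0 x
  -- the relation `f`, collected according to Kummer characters
  let F : (fixingRootsOfUnity (radicalField Γ) →* radicalField Γ) →₀ radicalField Γ :=
    ∑ x ∈ f.support, Finsupp.single (kummerChar x) (f x • u x)
  have hF : F = 0 := by
    refine linearIndependent_iff.1 (linearIndependent_monoidHom
      (fixingRootsOfUnity (radicalField Γ)) (radicalField Γ)) F ?_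
    funext σ
    rw [map_sum, Finset.sum_apply, Pi.zero_apply]
    have := congrArg (σ : Gal(radicalField Γ/ℚ)) hf
    rw [map_zero, Finsupp.linearCombination_apply, Finsupp.sum, map_sum] at this
    rw [← this]
    refine Finset.sum_congr rfl fun x _ => ?_
    rw [Finsupp.linearCombination_single, map_rat_smul, Pi.smul_apply, kummerChar_apply,
      smul_eq_mul, smul_mul_assoc, mul_div_cancel₀ _ (hu0 x)]
  have := congrArg (Finsupp.linearCombination (radicalField Γ) c) hF
  rw [map_sum, map_zero] at this
  rw [Finsupp.linearCombination_apply, Finsupp.sum, ← this]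
  refine Finset.sum_congr rfl fun x _ => ?_
  rw [Finsupp.linearCombination_single, hc, smul_eq_mul, smul_mul_assoc,
    mul_div_cancel₀ _ (hu0 x)]

/-! ### The quotient of `A` by the Galois group -/

/-- The rational numbers with a power in a finitely generated group represent only finitely many
square classes: the primes that divide the squarefree parts occur in the generators. -/
theorem exists_finite_square_classes {Γ : Subgroup ℚˣ} (hΓ : Γ.FG) : ∃ R : Set ℚˣ, R.Finite ∧
    ∀ (q : ℚˣ) (n : ℕ), n ≠ 0 → q ^ n ∈ Γ → ∃ ρ ∈ R, ∃ r : ℚˣ, q = ρ * r ^ 2 := by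
  obtain ⟨S, hS⟩ := hΓ
  set D : ℕ := ∏ s ∈ S, ((s : ℚ).num.natAbs * (s : ℚ).den) with hD
  have hD0 : D ≠ 0 := Finset.prod_ne_zero_iff.2 fun s _ => by simp
  have hval : ∀ p : ℕ, p.Prime → ¬ p ∣ D → ∀ q ∈ Γ, padicValRat p (q : ℚ) = 0 := by
    intro p hp hpD q hq
    have : Fact p.Prime := ⟨hp⟩
    rw [← hS] at hq
    induction hq using Subgroup.closure_induction with
    | mem s hs =>
      have hs' : ¬ p ∣ (s : ℚ).num.natAbs * (s : ℚ).den := fun h =>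
        hpD (h.trans (Finset.dvd_prod_of_mem _ hs))
      have h1 : ¬ p ∣ (s : ℚ).num.natAbs := fun h => hs' (h.mul_right _)
      have h2 : ¬ p ∣ (s : ℚ).den := fun h => hs' (h.mul_left _)
      simp [padicValRat_def, padicValInt, padicValNat.eq_zero_of_not_dvd h1,
        padicValNat.eq_zero_of_not_dvd h2]
    | one => simp
    | mul x y _ _ hx hy =>
      rw [Units.val_mul, padicValRat.mul x.ne_zero y.ne_zero, hx, hy, add_zero]
    | inv x _ hx => rw [Units.val_inv_eq_inv_val, padicValRat.inv, hx, neg_zero]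
  refine ⟨{ρ | ∃ m ∈ Set.Icc (-D : ℤ) D, (ρ : ℚ) = m}, ?_, fun q n hn hq => ?_⟩
  · have := ((Set.finite_Icc (-D : ℤ) D).image (fun m : ℤ => (m : ℚ)))
    refine (this.preimage (f := fun ρ : ℚˣ => (ρ : ℚ)) Units.val_injective.injOn).subset ?_
    rintro ρ ⟨m, hm, h⟩
    exact ⟨m, hm, h.symm⟩
  -- `q` differs from the integer `num * den` by the square of `den`
  obtain ⟨a, b, hab, ha⟩ := Nat.sq_mul_squarefree ((q : ℚ).num * (q : ℚ).den).natAbs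
  set s : ℤ := ((q : ℚ).num * (q : ℚ).den).sign with hs
  have hden : ((q : ℚ).den : ℚ) ≠ 0 := by simp
  have hnz : (q : ℚ).num * (q : ℚ).den ≠ 0 := by simp
  have hs0 : s ≠ 0 := by rwa [hs, Ne, Int.sign_eq_zero_iff_zero]
  have ha0 : a ≠ 0 := ha.ne_zero
  have hb0 : b ≠ 0 := by
    rintro rfl
    rw [zero_pow two_ne_zero, zero_mul] at hab
    exact hnz (Int.natAbs_eq_zero.1 hab.symm)
  have hmul : ((q : ℚ).num * (q : ℚ).den : ℤ) = s * (b ^ 2 * a : ℕ) := by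
    rw [hab, hs, Int.sign_mul_natAbs]
  have hqeq : (q : ℚ) = ((s * a : ℤ) : ℚ) * (b / (q : ℚ).den) ^ 2 := by
    have h1 := congrArg (fun z : ℤ => (z : ℚ)) hmul
    push_cast at h1 ⊢
    have h2 := Rat.num_div_den (q : ℚ)
    rw [div_eq_iff hden] at h2
    rw [div_pow, mul_div_assoc', eq_div_iff (pow_ne_zero 2 hden)]
    rw [h2] at h1
    linear_combination h1
  have hm0 : ((s * a : ℤ) : ℚ) ≠ 0 := by
    exact_mod_cast mul_ne_zero hs0 (by exact_mod_cast ha0)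
  have hr0 : ((b : ℚ) / (q : ℚ).den) ≠ 0 := div_ne_zero (by exact_mod_cast hb0) hden
  have habs : (s * a : ℤ).natAbs = a := by
    rw [Int.natAbs_mul, hs, Int.natAbs_sign_of_ne_zero hnz, one_mul, Int.natAbs_natCast]
  have hprime : ∀ p, p.Prime → p ∣ a → p ∣ D := by
    intro p hp hpa
    by_contra hpD
    have : Fact p.Prime := ⟨hp⟩
    have h1 := hval p hp hpD _ hq
    rw [Units.val_pow_eq_pow_val, padicValRat.pow, mul_eq_zero] at h1
    have h2 : padicValRat p (q : ℚ) = 0 := h1.resolve_left (by exact_mod_cast hn)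
    rw [hqeq, padicValRat.mul hm0 (pow_ne_zero 2 hr0), padicValRat.pow, padicValRat.of_int,
      padicValInt, habs] at h2
    have h3 : padicValNat p a = 1 := by
      refine le_antisymm ?_ (one_le_padicValNat_of_dvd ha0 hpa)
      rw [← Nat.factorization_def a hp]
      exact ha.natFactorization_le_one p
    rw [h3] at h2
    push_cast at h2
    omega
  have hle : a ≤ D := by
    refine Nat.le_of_dvd (Nat.pos_of_ne_zero hD0) ?_
    rw [← Nat.prod_primeFactors_of_squarefree ha]
    refine (Finset.prod_dvd_prod_of_subset _ _ _ fun p hp => ?_).trans (Nat.prod_primeFactors_dvd D)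
    exact Nat.mem_primeFactors.2 ⟨Nat.prime_of_mem_primeFactors hp,
      hprime p (Nat.prime_of_mem_primeFactors hp) (Nat.dvd_of_mem_primeFactors hp), hD0⟩
  refine ⟨Units.mk0 _ hm0, ⟨s * a, ?_, rfl⟩, Units.mk0 _ hr0, Units.ext hqeq⟩
  rw [Set.mem_Icc, ← abs_le, Int.abs_eq_natAbs, habs]
  exact_mod_cast hle

theorem ratUnits_injective : Function.Injective ratUnits :=
  Units.map_injective (algebraMap ℚ ℂ).injective

theorem mem_range_of_sq_eq {x : ℂˣ} {t : ℚˣ} (h : x ^ 2 = ratUnits (t ^ 2)) :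
    x ∈ ratUnits.range := by
  rw [map_pow] at h
  have h' : (x : ℂ) ^ 2 = (ratUnits t : ℂ) ^ 2 := by exact_mod_cast congrArg Units.val h
  rcases sq_eq_sq_iff_eq_or_eq_neg.1 h' with h1 | h1
  · exact ⟨t, Units.ext h1.symm⟩
  · refine ⟨-t, Units.ext ?_⟩
    rw [h1]
    simp [ratUnits]

theorem autInf_apply_of_sq_eq_one {Γ : Subgroup ℚˣ} (α : autInf Γ) {ε : radicalsInf Γ}
    (h : ε ^ 2 = 1) : (α : MulAut (radicalsInf Γ)) ε = ε :=
  radicalAut_apply α (mem_range_of_sq_eq (t := 1) (by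
    have := congrArg (Subtype.val : radicalsInf Γ → ℂˣ) h
    simpa using this))

/-- Automorphisms in `A` change the square roots of rational numbers by signs. -/
theorem exists_sign {Γ : Subgroup ℚˣ} (α : autInf Γ) {y : radicalsInf Γ}
    (hy : (y : ℂˣ) ^ 2 ∈ ratUnits.range) :
    ∃ ε : radicalsInf Γ, ε ^ 2 = 1 ∧ (α : MulAut (radicalsInf Γ)) y = ε * y := by
  refine ⟨(α : MulAut (radicalsInf Γ)) y * y⁻¹, ?_, (inv_mul_cancel_right _ _).symm⟩
  rw [mul_pow, inv_pow, mul_inv_eq_one]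
  exact Subtype.ext (radicalAut_pow α hy)

theorem autInf_comm_apply_sqrt {Γ : Subgroup ℚˣ} (α β : autInf Γ) {y : radicalsInf Γ}
    (hy : (y : ℂˣ) ^ 2 ∈ ratUnits.range) :
    (α : MulAut (radicalsInf Γ)) ((β : MulAut (radicalsInf Γ)) y) =
      (β : MulAut (radicalsInf Γ)) ((α : MulAut (radicalsInf Γ)) y) := by
  obtain ⟨ε, hε, h1⟩ := exists_sign α hy
  obtain ⟨δ, hδ, h2⟩ := exists_sign β hy
  rw [h1, h2, map_mul, map_mul, h1, h2, autInf_apply_of_sq_eq_one α hδ,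
    autInf_apply_of_sq_eq_one β hε, mul_left_comm]

theorem autInf_apply_apply_sqrt {Γ : Subgroup ℚˣ} (α : autInf Γ) {y : radicalsInf Γ}
    (hy : (y : ℂˣ) ^ 2 ∈ ratUnits.range) :
    (α : MulAut (radicalsInf Γ)) ((α : MulAut (radicalsInf Γ)) y) = y := by
  obtain ⟨ε, hε, h1⟩ := exists_sign α hy
  rw [h1, map_mul, h1, autInf_apply_of_sq_eq_one α hε, ← mul_assoc, ← sq, hε, one_mul]

/-- The subgroup of `A` of the automorphisms that fix all roots of unity. -/
def fixingTorsion (Γ : Subgroup ℚˣ) : Subgroup (autInf Γ) :=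
  (fixingSubgroup (MulAut (radicalsInf Γ)) {ζ : radicalsInf Γ | IsOfFinOrder ζ}).subgroupOf (autInf Γ)

theorem mem_fixingTorsion {Γ : Subgroup ℚˣ} {α : autInf Γ} : α ∈ fixingTorsion Γ ↔
    ∀ ζ : radicalsInf Γ, IsOfFinOrder ζ → (α : MulAut (radicalsInf Γ)) ζ = ζ := by
  rw [fixingTorsion, Subgroup.mem_subgroupOf, mem_fixingSubgroup_iff]
  rfl

/-- Since `G` surjects onto the automorphism group of the group of roots of unity, every coset of
`G` contains an automorphism that fixes all roots of unity. -/
theorem exists_mem_fixingTorsion {Γ : Subgroup ℚˣ} (α : autInf Γ) :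
    ∃ g ∈ galImage Γ, ∃ n ∈ fixingTorsion Γ, α = g * n := by
  obtain ⟨g, hg, h⟩ := exists_mem_galImage_eq_on_torsion α
  refine ⟨g, hg, g⁻¹ * α, mem_fixingTorsion.2 fun ζ hζ => ?_, (mul_inv_cancel_left _ _).symm⟩
  rw [Subgroup.coe_mul, MulAut.mul_apply, ← h ζ hζ, Subgroup.coe_inv, MulAut.inv_apply_self]

theorem sq_apply_mem_range {Γ : Subgroup ℚˣ} (α : autInf Γ) {y : radicalsInf Γ}
    (hy : (y : ℂˣ) ^ 2 ∈ ratUnits.range) :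
    (((α : MulAut (radicalsInf Γ)) y : radicalsInf Γ) : ℂˣ) ^ 2 ∈ ratUnits.range := by
  rwa [radicalAut_pow α hy]

theorem isOfFinOrder_apply {Γ : Subgroup ℚˣ} (α : autInf Γ) {ζ : radicalsInf Γ}
    (hζ : IsOfFinOrder ζ) : IsOfFinOrder ((α : MulAut (radicalsInf Γ)) ζ) :=
  (α : MulAut (radicalsInf Γ)).toMonoidHom.isOfFinOrder hζ

/-- Modulo `G`, the automorphisms that fix all roots of unity are central. -/
theorem commutator_mem_galImage {Γ : Subgroup ℚˣ} {n : autInf Γ} (hn : n ∈ fixingTorsion Γ)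
    (α : autInf Γ) : n * α * n⁻¹ * α⁻¹ ∈ galImage Γ := by
  refine mem_galImage_of_eq_on_sqrt (fun ζ hζ => ?_) fun y hy => ?_
  · have h1 := mem_fixingTorsion.1 (inv_mem hn) _ (isOfFinOrder_apply α⁻¹ hζ)
    simp only [Subgroup.coe_mul, MulAut.mul_apply, h1]
    rw [Subgroup.coe_inv, MulAut.apply_inv_self]
    exact mem_fixingTorsion.1 hn ζ hζ
  · have h1 := autInf_comm_apply_sqrt n α
      (sq_apply_mem_range n⁻¹ (sq_apply_mem_range α⁻¹ hy))
    simp only [Subgroup.coe_mul, MulAut.mul_apply, h1]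
    rw [Subgroup.coe_inv, MulAut.apply_inv_self, Subgroup.coe_inv, MulAut.apply_inv_self]

theorem galImage_normal (Γ : Subgroup ℚˣ) : (galImage Γ).Normal := by
  refine ⟨fun h hh α => ?_⟩
  obtain ⟨g, hg, n, hn, rfl⟩ := exists_mem_fixingTorsion α
  have : g * n * h * (g * n)⁻¹ = g * ((n * h * n⁻¹ * h⁻¹) * h) * g⁻¹ := by group
  rw [this]
  exact mul_mem (mul_mem hg (mul_mem (commutator_mem_galImage hn h) hh)) (inv_mem hg)

theorem sq_mem_galImage {Γ : Subgroup ℚˣ} (α : autInf Γ) : α ^ 2 ∈ galImage Γ := by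
  obtain ⟨g, hg, n, hn, rfl⟩ := exists_mem_fixingTorsion α
  have hn2 : n * n ∈ galImage Γ := by
    refine mem_galImage_of_eq_on_sqrt (fun ζ hζ => ?_) fun y hy => autInf_apply_apply_sqrt n hy
    exact mem_fixingTorsion.1 (mul_mem hn hn) ζ hζ
  have : (g * n) ^ 2 = g * ((n * g * n⁻¹ * g⁻¹) * g) * (n * n) := by rw [sq]; group
  rw [this]
  exact mul_mem (mul_mem hg (mul_mem (commutator_mem_galImage hn g) hg)) hn2

/-- The action of an automorphism on all square roots in a given square class is determined by the
action on one of them, and there are finitely many square classes. -/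
theorem finite_quotient_galImage {Γ : Subgroup ℚˣ} (hΓ : Γ.FG) :
    Finite (autInf Γ ⧸ galImage Γ) := by
  obtain ⟨R, hR, hR'⟩ := exists_finite_square_classes hΓ
  have : Finite R := hR
  have hN := galImage_normal Γ
  have hrep : ∀ c : autInf Γ ⧸ galImage Γ, ∃ n ∈ fixingTorsion Γ,
      (n : autInf Γ ⧸ galImage Γ) = c := by
    intro c
    obtain ⟨α, rfl⟩ := QuotientGroup.mk_surjective c
    obtain ⟨g, hg, n, hn, rfl⟩ := exists_mem_fixingTorsion α
    refine ⟨n, hn, ?_⟩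
    rw [QuotientGroup.mk_mul, (QuotientGroup.eq_one_iff g).2 hg, one_mul]
  choose n hn hnc using hrep
  -- A coset is recorded by the square classes whose square roots its representative fixes.
  refine Finite.of_injective (fun c => fun ρ : R => ∀ (y : radicalsInf Γ) (r : ℚˣ),
    (y : ℂˣ) ^ 2 = ratUnits (ρ * r ^ 2) → (n c : MulAut (radicalsInf Γ)) y = y) fun c d hcd => ?_
  rw [← hnc c, ← hnc d, QuotientGroup.eq]
  refine mem_galImage_of_eq_on_sqrt (mem_fixingTorsion.1 (mul_mem (inv_mem (hn c)) (hn d)))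
    fun y hy => ?_
  rw [Subgroup.coe_mul, MulAut.mul_apply, Subgroup.coe_inv, MulAut.inv_apply,
    MulEquiv.symm_apply_eq]
  obtain ⟨q, hq⟩ := hy
  obtain ⟨m, hm, t, ht, hty⟩ := y.2
  obtain ⟨ρ, hρ, r, rfl⟩ := hR' q m (by simpa using hm) (by
    have : q ^ m = t ^ 2 := ratUnits_injective (by
      rw [map_pow, map_pow, hq, hty, ← pow_mul, ← pow_mul, mul_comm])
    exact this ▸ pow_mem ht 2)
  have hcd' := congrFun hcd ⟨ρ, hρ⟩
  simp only [eq_iff_iff] at hcd'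
  by_cases hfix : ∀ (y : radicalsInf Γ) (r : ℚˣ),
    (y : ℂˣ) ^ 2 = ratUnits (ρ * r ^ 2) → (n c : MulAut (radicalsInf Γ)) y = y
  · rw [hfix y r hq.symm, hcd'.1 hfix y r hq.symm]
  · -- An automorphism that moves one square root in the class negates all of them, because two such
    -- square roots have a rational quotient.
    have key : ∀ α : autInf Γ, (¬ ∀ (y : radicalsInf Γ) (r : ℚˣ),
        (y : ℂˣ) ^ 2 = ratUnits (ρ * r ^ 2) → (α : MulAut (radicalsInf Γ)) y = y) →
        ((((α : MulAut (radicalsInf Γ)) y : radicalsInf Γ) : ℂˣ) : ℂ) = -((y : ℂˣ) : ℂ) := by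
      intro α hα
      have hne : (α : MulAut (radicalsInf Γ)) y ≠ y := by
        intro hαy
        refine hα fun y' r' hy' => ?_
        have hrat : ((y' * y⁻¹ : radicalsInf Γ) : ℂˣ) ∈ ratUnits.range := by
          refine mem_range_of_sq_eq (t := r' * r⁻¹) ?_
          rw [Subgroup.coe_mul, Subgroup.coe_inv, mul_pow, inv_pow, hy', ← hq, ← map_inv,
            ← map_mul]
          congr 1
          rw [mul_pow, inv_pow, mul_inv, mul_mul_mul_comm, mul_inv_cancel, one_mul]
        have h1 := radicalAut_apply α hrat
        rwa [map_mul, map_inv, hαy, mul_left_inj] at h1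
      have h2 : ((((α : MulAut (radicalsInf Γ)) y : radicalsInf Γ) : ℂˣ) : ℂ) ^ 2 =
          ((y : ℂˣ) : ℂ) ^ 2 := by
        exact_mod_cast congrArg Units.val (radicalAut_pow α ⟨_, hq⟩)
      exact (sq_eq_sq_iff_eq_or_eq_neg.1 h2).resolve_left
        fun h => hne (Subtype.ext (Units.ext h))
    refine Subtype.ext (Units.ext ?_)
    rw [key _ hfix, key _ (hcd'.not.1 hfix)]

/-! ### Quadratic characters -/

theorem isOpen_galImage {Γ : Subgroup ℚˣ} (hΓ : Γ.FG) : IsOpen (galImage Γ : Set (autInf Γ)) := by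
  have := finite_quotient_galImage hΓ
  have : (galImage Γ).FiniteIndex := Subgroup.finiteIndex_of_finite_quotient
  exact Subgroup.isOpen_of_isClosed_of_finiteIndex _ (isClosed_galImage Γ)

theorem MonoidHom.continuous_of_isOpen_ker {G H : Type*} [Group G] [TopologicalSpace G]
    [IsTopologicalGroup G] [Group H] [TopologicalSpace H] (f : G →* H)
    (hf : IsOpen (f.ker : Set G)) : Continuous f := by
  refine continuous_def.2 fun s _ => isOpen_iff_mem_nhds.2 fun g hg => ?_
  have h1 : (fun x => g⁻¹ * x) ⁻¹' (f.ker : Set G) ∈ 𝓝 g :=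
    (hf.preimage (continuous_const_mul g⁻¹)).mem_nhds (by simp)
  filter_upwards [h1] with x hx
  have h2 : f g = f x := by simpa [MonoidHom.mem_ker, inv_mul_eq_one] using hx
  rwa [Set.mem_preimage, ← h2]

section Characters

variable {Γ : Subgroup ℚˣ} {χ : autInf Γ →* ℤˣ}

theorem continuous_primaryPart (hχ : IsOpen (χ.ker : Set (autInf Γ))) (p : Nat.Primes) :
    Continuous (primaryPart χ p) :=
  (χ.continuous_of_isOpen_ker hχ).comp
    ((continuous_autEquiv_symm Γ).comp (continuous_mulSingle (A := fun q => autPrim Γ q) p))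

theorem primaryPart_apply (p : Nat.Primes) (a : autPrim Γ p) :
    primaryPart χ p a = χ ((autEquiv Γ).symm (Pi.mulSingle p a)) := rfl

/-- By the definition of the product topology, an open kernel contains all but finitely many of the
factors `A_p`, together with their closed product. -/
theorem exists_finset_primes (hχ : IsOpen (χ.ker : Set (autInf Γ))) :
    ∃ I : Finset Nat.Primes, ∀ a : ∀ p : Nat.Primes, autPrim Γ p,
      (∀ p ∈ I, a p = 1) → χ ((autEquiv Γ).symm a) = 1 := by
  have hopen : IsOpen ((autEquiv Γ).symm ⁻¹' (χ.ker : Set (autInf Γ))) :=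
    hχ.preimage (continuous_autEquiv_symm Γ)
  obtain ⟨I, u, hu, hI⟩ := isOpen_pi_iff.1 hopen 1 (by simp)
  refine ⟨I, fun a ha => hI fun p hp => ?_⟩
  rw [ha p hp]
  exact (hu p hp).2

theorem exists_finset_eq_prod_primaryPart (hχ : IsOpen (χ.ker : Set (autInf Γ))) :
    ∃ I : Finset Nat.Primes, (∀ p ∉ I, primaryPart χ p = 1) ∧
      ∀ α : autInf Γ, χ α = ∏ p ∈ I, primaryPart χ p (autEquiv Γ α p) := by
  obtain ⟨I, hI⟩ := exists_finset_primes hχ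
  refine ⟨I, fun p hp => MonoidHom.ext fun a => ?_, fun α => ?_⟩
  · refine hI _ fun q hq => Pi.mulSingle_eq_of_ne (fun h => hp ?_) _
    rwa [← h]
  · set a := autEquiv Γ α with ha
    set b : ∀ p : Nat.Primes, autPrim Γ p := fun p => if p ∈ I then a p else 1 with hb
    have h1 : χ ((autEquiv Γ).symm (b⁻¹ * a)) = 1 := hI _ fun p hp => by simp [hb, hp]
    rw [map_mul, map_mul, map_inv, map_inv, inv_mul_eq_one, ha, MulEquiv.symm_apply_apply] at h1
    rw [← h1]
    -- the finitely supported element `b` is a product of elements of the factors `A_p`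
    have key : ∀ J : Finset Nat.Primes, χ ((autEquiv Γ).symm fun p => if p ∈ J then a p else 1) =
        ∏ p ∈ J, primaryPart χ p (a p) := by
      intro J
      induction J using Finset.induction_on with
      | empty =>
        simp only [Finset.notMem_empty, if_false, Finset.prod_empty]
        exact (congrArg χ (map_one (autEquiv Γ).symm)).trans (map_one χ)
      | insert q J hq ih =>
        rw [Finset.prod_insert hq, ← ih, primaryPart_apply, ← map_mul, ← map_mul]
        congr 2
        funext p
        rw [Pi.mul_apply]
        by_cases hpq : p = q
        · subst hpq
          simp [hq]
        · simp [hpq]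
    exact key I

end Characters

section Orthogonality

variable {Q : Type*} [Group Q] [Finite Q]

theorem finite_monoidHom_intUnits : Finite (Q →* ℤˣ) :=
  Finite.of_injective (fun f => (f : Q → ℤˣ)) DFunLike.coe_injective

/-- The characters with values in `{±1}` separate the elements of an elementary abelian `2`-group.
-/
theorem exists_monoidHom_intUnits_ne_one (h2 : ∀ x : Q, x ^ 2 = 1) {a : Q} (ha : a ≠ 1) :
    ∃ χ : Q →* ℤˣ, χ a ≠ 1 := by
  have hexp : Monoid.exponent Q ∣ 2 := Monoid.exponent_dvd_of_forall_pow_eq_one h2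
  have hcomm : ∀ x y : Q, x * y = y * x := fun x y => by
    have hinv : ∀ z : Q, z⁻¹ = z := fun z => inv_eq_of_mul_eq_one_left (by rw [← sq, h2])
    rw [← hinv (x * y), mul_inv_rev, hinv, hinv]
  let _ : CommGroup Q := { (inferInstance : Group Q) with mul_comm := hcomm }
  have : HasEnoughRootsOfUnity ℤ 2 :=
    { prim := ⟨-1, IsPrimitiveRoot.neg_one 0 (by norm_num)⟩
      cyc := inferInstance }
  have := HasEnoughRootsOfUnity.of_dvd ℤ hexp
  exact CommGroup.exists_apply_ne_one_of_hasEnoughRootsOfUnity Q ℤ ha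

open Classical in
theorem finsum_monoidHom_intUnits (h2 : ∀ x : Q, x ^ 2 = 1) (a : Q) :
    ∑ᶠ χ : Q →* ℤˣ, (((χ a : ℤˣ) : ℤ) : ℝ) = if a = 1 then (Nat.card (Q →* ℤˣ) : ℝ) else 0 := by
  have := finite_monoidHom_intUnits (Q := Q)
  let _ := Fintype.ofFinite (Q →* ℤˣ)
  rw [finsum_eq_sum_of_fintype]
  split_ifs with ha
  · simp [ha, Nat.card_eq_fintype_card]
  · obtain ⟨φ, hφ⟩ := exists_monoidHom_intUnits_ne_one h2 ha
    have hφ' : φ a = -1 := (Int.units_eq_one_or _).resolve_left hφ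
    have h := Equiv.sum_comp (Equiv.mulLeft φ) (fun χ : Q →* ℤˣ => (((χ a : ℤˣ) : ℤ) : ℝ))
    simp only [Equiv.coe_mulLeft, MonoidHom.mul_apply, hφ', neg_mul, one_mul, Units.val_neg,
      Int.cast_neg, Finset.sum_neg_distrib] at h
    linarith

end Orthogonality

/-! ### Integration over product sets -/

section InfiniteProduct

variable {ι : Type*} {X : ι → Type*} {mX : ∀ i, MeasurableSpace (X i)}
  {μ : ∀ i, Measure (X i)} [∀ i, IsProbabilityMeasure (μ i)]

theorem integral_infinitePi_prod (J : Finset ι) {g : ∀ i, X i → ℝ} (hg : ∀ i, Measurable (g i)) :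
    ∫ x, ∏ i ∈ J, g i (x i) ∂(Measure.infinitePi μ) = ∏ i ∈ J, ∫ x, g i x ∂(μ i) := by
  have hm : Measurable fun y : ∀ i : J, X i => ∏ i : J, g i (y i) :=
    Finset.measurable_prod _ fun i _ => (hg i).comp (measurable_pi_apply i)
  have h1 : ∀ x : ∀ i, X i, ∏ i ∈ J, g i (x i) =
      (fun y : ∀ i : J, X i => ∏ i : J, g i (y i)) (J.restrict x) := fun x =>
    (Finset.prod_coe_sort J fun i => g i (x i)).symm
  simp_rw [h1]
  rw [← integral_map (by fun_prop) hm.aestronglyMeasurable, Measure.infinitePi_map_restrict,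
    integral_fintype_prod_eq_prod (fun i : J => g i)]
  exact Finset.prod_coe_sort J fun i => ∫ x, g i x ∂(μ i)

/-- The finite partial products of the integrals over the factors converge to the integral over
the infinite product set, by dominated convergence. -/
theorem tendsto_prod_setIntegral_infinitePi [Countable ι] {S : ∀ i, Set (X i)}
    (hS : ∀ i, MeasurableSet (S i)) {f : ∀ i, X i → ℝ} (hf : ∀ i, Measurable (f i))
    (hf1 : ∀ i x, |f i x| ≤ 1) {I : Finset ι} (hI : ∀ i ∉ I, ∀ x, f i x = 1) :
    Filter.Tendsto (fun J : Finset ι => ∏ i ∈ J, ∫ x in S i, f i x ∂(μ i)) Filter.atTop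
      (𝓝 (∫ x in Set.univ.pi S, ∏ i ∈ I, f i (x i) ∂(Measure.infinitePi μ))) := by
  have hg : ∀ i, Measurable ((S i).indicator (f i)) := fun i => (hf i).indicator (hS i)
  have hSm : MeasurableSet (Set.univ.pi S) := MeasurableSet.univ_pi hS
  simp_rw [← integral_indicator (hS _), ← integral_infinitePi_prod _ hg]
  rw [← integral_indicator hSm]
  refine tendsto_integral_filter_of_dominated_convergence (fun _ => 1)
    (Filter.Eventually.of_forall fun J => ?_)
    (Filter.Eventually.of_forall fun J => Filter.Eventually.of_forall fun x => ?_)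
    (integrable_const _) (Filter.Eventually.of_forall fun x => ?_)
  · exact (Finset.measurable_prod _ fun i _ =>
      (hg i).comp (measurable_pi_apply i)).aestronglyMeasurable
  · rw [Real.norm_eq_abs, Finset.abs_prod]
    refine Finset.prod_le_one (fun i _ => abs_nonneg _) fun i _ => ?_
    by_cases hx : x i ∈ S i
    · rw [Set.indicator_of_mem hx]
      exact hf1 i _
    · simp [Set.indicator_of_notMem hx]
  · refine tendsto_const_nhds.congr' ?_
    by_cases hx : x ∈ Set.univ.pi S
    · filter_upwards [Filter.eventually_ge_atTop I] with J hJ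
      rw [Set.indicator_of_mem hx]
      refine (Finset.prod_subset hJ fun i _ hi => hI i hi _).trans
        (Finset.prod_congr rfl fun i _ => ?_)
      rw [Set.indicator_of_mem (hx i trivial)]
    · obtain ⟨i, hi⟩ : ∃ i, x i ∉ S i := by simpa [Set.mem_pi] using hx
      filter_upwards [Filter.eventually_ge_atTop {i}] with J hJ
      rw [Set.indicator_of_notMem hx]
      refine (Finset.prod_eq_zero (Finset.singleton_subset_iff.1 hJ) ?_).symm
      rw [Set.indicator_of_notMem hi]

/-- On an infinite product set, the average of a product of functions of finitely many coordinates
is the product of the averages. This form stays true if the product set has measure zero. -/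
theorem setIntegral_infinitePi_eq_prod_average_mul [Countable ι] {S : ∀ i, Set (X i)}
    (hS : ∀ i, MeasurableSet (S i)) (hpos : ∀ i, 0 < μ i (S i)) {f : ∀ i, X i → ℝ}
    (hf : ∀ i, Measurable (f i)) (hf1 : ∀ i x, |f i x| ≤ 1) {I : Finset ι}
    (hI : ∀ i ∉ I, ∀ x, f i x = 1) :
    ∫ x in Set.univ.pi S, ∏ i ∈ I, f i (x i) ∂(Measure.infinitePi μ) =
      (∏ i ∈ I, ((μ i).real (S i))⁻¹ * ∫ x in S i, f i x ∂(μ i)) *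
        (Measure.infinitePi μ).real (Set.univ.pi S) := by
  have h1 := tendsto_prod_setIntegral_infinitePi (μ := μ) hS hf hf1 hI
  have h2 := tendsto_prod_setIntegral_infinitePi (μ := μ) hS (f := fun _ _ => 1)
    (fun _ => measurable_const) (fun _ _ => by simp) (I := I) (fun _ _ _ => rfl)
  simp only [Finset.prod_const_one, integral_const, smul_eq_mul, mul_one,
    measureReal_restrict_apply_univ] at h2
  refine tendsto_nhds_unique h1 ((h2.const_mul _).congr' ?_)
  filter_upwards [Filter.eventually_ge_atTop I] with J hJ
  have hne : ∀ i, (μ i).real (S i) ≠ 0 := fun i =>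
    (ENNReal.toReal_pos (hpos i).ne' (measure_ne_top _ _)).ne'
  rw [Finset.prod_subset hJ (f := fun i => ((μ i).real (S i))⁻¹ * ∫ x in S i, f i x ∂(μ i)),
    ← Finset.prod_mul_distrib]
  · refine Finset.prod_congr rfl fun i _ => ?_
    rw [mul_right_comm, inv_mul_cancel₀ (hne i), one_mul]
  · intro i _ hi
    simp [hI i hi, hne i]

/-- The same product formula on a probability space that is identified with an infinite product. -/
theorem setIntegral_preimage_pi_eq_prod_average_mul [Countable ι] {Ω : Type*}
    {mΩ : MeasurableSpace Ω} {ν : Measure Ω} {e : Ω → ∀ i, X i} (he : Measurable e)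
    (hν : ν.map e = Measure.infinitePi μ) {S : ∀ i, Set (X i)}
    (hS : ∀ i, MeasurableSet (S i)) (hpos : ∀ i, 0 < μ i (S i)) {f : ∀ i, X i → ℝ}
    (hf : ∀ i, Measurable (f i)) (hf1 : ∀ i x, |f i x| ≤ 1) {I : Finset ι}
    (hI : ∀ i ∉ I, ∀ x, f i x = 1) :
    ∫ ω in e ⁻¹' Set.univ.pi S, ∏ i ∈ I, f i (e ω i) ∂ν =
      (∏ i ∈ I, ((μ i).real (S i))⁻¹ * ∫ x in S i, f i x ∂(μ i)) *
        ν.real (e ⁻¹' Set.univ.pi S) := by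
  have hSm : MeasurableSet (Set.univ.pi S) := MeasurableSet.univ_pi hS
  have hfm : Measurable fun x : ∀ i, X i => ∏ i ∈ I, f i (x i) :=
    Finset.measurable_prod _ fun i _ => (hf i).comp (measurable_pi_apply i)
  rw [← map_measureReal_apply he hSm, hν,
    ← setIntegral_infinitePi_eq_prod_average_mul hS hpos hf hf1 hI, ← hν]
  exact (setIntegral_map hSm hfm.aestronglyMeasurable he.aemeasurable).symm

end InfiniteProduct

section Density

variable {Γ : Subgroup ℚˣ}

theorem prodSet_eq_preimage (S : ∀ p : Nat.Primes, Set (autPrim Γ p)) :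
    prodSet Γ S = autEquiv Γ ⁻¹' Set.univ.pi S := by
  ext α
  simp [prodSet, Set.mem_pi]

theorem measurable_autEquiv : Measurable (autEquiv Γ) := (continuous_autEquiv Γ).measurable

theorem map_autEquiv_haarInf : (haarInf Γ).map (autEquiv Γ) = Measure.infinitePi (haarPrim Γ) := by
  rw [haarInf, Measure.map_map measurable_autEquiv (measurable_autEquiv_symm Γ)]
  have : autEquiv Γ ∘ (autEquiv Γ).symm = id := by
    funext a
    exact (autEquiv Γ).apply_symm_apply a
  rw [this, Measure.map_id]

theorem localFactor_eq_one {χ : autInf Γ →* ℤˣ}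
    {S : ∀ p : Nat.Primes, Set (autPrim Γ p)} (hpos : ∀ p, 0 < haarPrim Γ p (S p))
    {p : Nat.Primes} (hp : primaryPart χ p = 1) : localFactor S χ p = 1 := by
  have hne : (haarPrim Γ p).real (S p) ≠ 0 :=
    (ENNReal.toReal_pos (hpos p).ne' (measure_ne_top _ _)).ne'
  simp [localFactor, hp, hne]

/-- A continuous quadratic character is a product of characters of the factors `A_p`, so its
average over a product set is the product of the local averages. -/
theorem setIntegral_prodSet_character {χ : autInf Γ →* ℤˣ}
    (hχ : IsOpen (χ.ker : Set (autInf Γ))) {S : ∀ p : Nat.Primes, Set (autPrim Γ p)}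
    (hS : ∀ p, MeasurableSet (S p)) (hpos : ∀ p, 0 < haarPrim Γ p (S p)) :
    ∫ α in prodSet Γ S, ((χ α : ℤ) : ℝ) ∂(haarInf Γ) =
      characterFactor S χ * (haarInf Γ).real (prodSet Γ S) := by
  obtain ⟨I, hI, hprod⟩ := exists_finset_eq_prod_primaryPart hχ
  let f : ∀ p, autPrim Γ p → ℝ := fun p a => ((primaryPart χ p a : ℤ) : ℝ)
  have hf : ∀ p, Measurable (f p) := fun p =>
    ((continuous_of_discreteTopology (f := fun u : ℤˣ => ((u : ℤ) : ℝ))).comp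
      (continuous_primaryPart hχ p)).measurable
  have hf1 : ∀ p a, |f p a| ≤ 1 := by
    intro p a
    rcases Int.units_eq_one_or (primaryPart χ p a) with h | h <;> simp [f, h]
  have hfI : ∀ p ∉ I, ∀ a, f p a = 1 := by
    intro p hp a
    simp [f, hI p hp]
  have hχf : ∀ α, ((χ α : ℤ) : ℝ) = ∏ p ∈ I, f p (autEquiv Γ α p) := by
    intro α
    rw [hprod α]
    simp [f, Units.coe_prod]
  have hfac : characterFactor S χ = ∏ p ∈ I, localFactor S χ p := by
    refine finprod_eq_prod_of_mulSupport_subset _ fun p hp => ?_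
    by_contra hpI
    exact hp (localFactor_eq_one hpos (hI p hpI))
  have h := setIntegral_preimage_pi_eq_prod_average_mul measurable_autEquiv map_autEquiv_haarInf
    hS hpos hf hf1 hfI
  rw [hfac, prodSet_eq_preimage]
  simp_rw [hχf]
  exact h

/-- A nontrivial character has average zero over `A`, by invariance of the Haar measure. -/
theorem integral_character_eq_zero {χ : autInf Γ →* ℤˣ} (hχ : χ ≠ 1) :
    ∫ α, ((χ α : ℤ) : ℝ) ∂(haarInf Γ) = 0 := by
  have hinv : (haarInf Γ).IsMulLeftInvariant := by
    rw [haarInf_eq_haarMeasure]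
    infer_instance
  obtain ⟨a, ha⟩ : ∃ a, χ a ≠ 1 := by
    by_contra! h
    exact hχ (MonoidHom.ext h)
  have ha' : χ a = -1 := (Int.units_eq_one_or _).resolve_left ha
  have h := integral_mul_left_eq_self (μ := haarInf Γ) (fun α => ((χ α : ℤ) : ℝ)) a
  simp only [map_mul, ha', neg_mul, one_mul, Units.val_neg, Int.cast_neg, integral_neg] at h
  linarith

end Density

/-! ### The density formula -/

section Density

variable {Γ : Subgroup ℚˣ}

/-- Almost everywhere equal factors have almost everywhere equal products, since there are only
countably many factors. -/
theorem prodSet_ae_eq {S T : ∀ p : Nat.Primes, Set (autPrim Γ p)}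
    (h : ∀ p, S p =ᵐ[haarPrim Γ p] T p) : prodSet Γ S =ᵐ[haarInf Γ] prodSet Γ T := by
  have h1 : ∀ p, ∀ᵐ α ∂(haarInf Γ), autEquiv Γ α p ∈ S p ↔ autEquiv Γ α p ∈ T p := by
    intro p
    have h2 : ∀ᵐ x ∂((haarInf Γ).map (autEquiv Γ)), x p ∈ S p ↔ x p ∈ T p := by
      rw [map_autEquiv_haarInf]
      exact (measurePreserving_eval_infinitePi (haarPrim Γ) p).quasiMeasurePreserving.ae
        (h p).mem_iff
    exact ae_of_ae_map measurable_autEquiv.aemeasurable h2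
  filter_upwards [ae_all_iff.2 h1] with α hα
  exact propext (forall_congr' hα)

theorem localFactor_congr_ae {S T : ∀ p : Nat.Primes, Set (autPrim Γ p)}
    (h : ∀ p, S p =ᵐ[haarPrim Γ p] T p) (χ : autInf Γ →* ℤˣ) (p : Nat.Primes) :
    localFactor S χ p = localFactor T χ p := by
  rw [localFactor, localFactor, measureReal_congr (h p), setIntegral_congr_set (h p)]

theorem characterFactor_congr_ae {S T : ∀ p : Nat.Primes, Set (autPrim Γ p)}
    (h : ∀ p, S p =ᵐ[haarPrim Γ p] T p) (χ : autInf Γ →* ℤˣ) :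
    characterFactor S χ = characterFactor T χ :=
  finprod_congr (localFactor_congr_ae h χ)

theorem quotient_sq_eq_one [(galImage Γ).Normal] (c : autInf Γ ⧸ galImage Γ) : c ^ 2 = 1 := by
  obtain ⟨α, rfl⟩ := QuotientGroup.mk_surjective c
  rw [← QuotientGroup.mk_pow]
  exact (QuotientGroup.eq_one_iff _).2 (sq_mem_galImage α)

theorem isOpen_ker_comp_mk' [(galImage Γ).Normal] (hΓ : Γ.FG)
    (χ : autInf Γ ⧸ galImage Γ →* ℤˣ) :
    IsOpen ((χ.comp (QuotientGroup.mk' (galImage Γ))).ker : Set (autInf Γ)) := by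
  refine Subgroup.isOpen_mono (H₁ := galImage Γ) (fun g hg => ?_) (isOpen_galImage hΓ)
  rw [MonoidHom.mem_ker, MonoidHom.comp_apply, QuotientGroup.mk'_apply,
    (QuotientGroup.eq_one_iff g).2 hg, map_one]

/-- Orthogonality of characters: the characters of `A / G` sum to a multiple of the indicator
function of `G`. -/
theorem sum_setIntegral_character [(galImage Γ).Normal] (hΓ : Γ.FG) (P : Set (autInf Γ)) :
    ∑ᶠ χ : autInf Γ ⧸ galImage Γ →* ℤˣ,
        ∫ α in P, (((χ.comp (QuotientGroup.mk' (galImage Γ))) α : ℤ) : ℝ) ∂(haarInf Γ) =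
      Nat.card (autInf Γ ⧸ galImage Γ →* ℤˣ) *
        (haarInf Γ).real ((galImage Γ : Set (autInf Γ)) ∩ P) := by
  classical
  have := finite_quotient_galImage hΓ
  have := finite_monoidHom_intUnits (Q := autInf Γ ⧸ galImage Γ)
  let _ := Fintype.ofFinite (autInf Γ ⧸ galImage Γ →* ℤˣ)
  have hGm : MeasurableSet (galImage Γ : Set (autInf Γ)) := (isOpen_galImage hΓ).measurableSet
  have hint : ∀ χ : autInf Γ ⧸ galImage Γ →* ℤˣ, Integrable (fun α : autInf Γ =>
      (((χ.comp (QuotientGroup.mk' (galImage Γ))) α : ℤ) : ℝ)) ((haarInf Γ).restrict P) := by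
    intro χ
    refine Integrable.of_bound (C := 1) ?_ (Filter.Eventually.of_forall fun α => ?_)
    · exact ((continuous_of_discreteTopology (f := fun u : ℤˣ => ((u : ℤ) : ℝ))).comp
        (MonoidHom.continuous_of_isOpen_ker _ (isOpen_ker_comp_mk' hΓ χ))).aestronglyMeasurable
    · rcases Int.units_eq_one_or ((χ.comp (QuotientGroup.mk' (galImage Γ))) α) with h | h <;>
        simp [h]
  rw [finsum_eq_sum_of_fintype, ← integral_finsetSum _ fun χ _ => hint χ]
  have hsum : ∀ α : autInf Γ, ∑ χ : autInf Γ ⧸ galImage Γ →* ℤˣ,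
      (((χ.comp (QuotientGroup.mk' (galImage Γ))) α : ℤ) : ℝ) =
      (galImage Γ : Set (autInf Γ)).indicator
        (fun _ => (Nat.card (autInf Γ ⧸ galImage Γ →* ℤˣ) : ℝ)) α := by
    intro α
    have h := finsum_monoidHom_intUnits quotient_sq_eq_one (α : autInf Γ ⧸ galImage Γ)
    rw [finsum_eq_sum_of_fintype] at h
    simp only [QuotientGroup.eq_one_iff] at h
    exact h
  simp_rw [hsum]
  rw [integral_indicator hGm, setIntegral_const, smul_eq_mul, mul_comm,
    measureReal_restrict_apply hGm]

theorem card_mul_measure_galImage [(galImage Γ).Normal] (hΓ : Γ.FG) :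
    Nat.card (autInf Γ ⧸ galImage Γ →* ℤˣ) * (haarInf Γ).real (galImage Γ : Set (autInf Γ)) = 1 := by
  have h := sum_setIntegral_character hΓ Set.univ
  rw [Set.inter_univ] at h
  rw [← h, finsum_eq_single _ 1]
  · simp
  · intro χ hχ
    rw [setIntegral_univ]
    refine integral_character_eq_zero fun h1 => hχ (MonoidHom.ext fun c => ?_)
    obtain ⟨α, rfl⟩ := QuotientGroup.mk_surjective c
    exact DFunLike.congr_fun h1 α

end Density

theorem theorem3p2 (Γ : Subgroup ℚˣ) (hΓ : Γ.FG)
    (S : ∀ p : Nat.Primes, Set (autPrim Γ p))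
    (hS : ∀ p, NullMeasurableSet (S p) (haarPrim Γ p))
    (hpos : ∀ p, 0 < haarPrim Γ p (S p)) :
    ∃ _ : (galImage Γ).Normal,
      -- the dual group `X = Hom(A/G, μ₂)` is finite
      Finite (autInf Γ ⧸ galImage Γ →* ℤˣ) ∧
      -- each `χ ∈ X` is the product of its primary components, which are continuous
      -- and almost all trivial
      (∀ χ : autInf Γ ⧸ galImage Γ →* ℤˣ,
        (∀ p, Continuous (primaryPart (χ.comp (QuotientGroup.mk' _)) p)) ∧
        {p | primaryPart (χ.comp (QuotientGroup.mk' _)) p ≠ 1}.Finite ∧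
        ∀ α : autInf Γ,
          χ α = ∏ᶠ p, primaryPart (χ.comp (QuotientGroup.mk' _)) p (autEquiv Γ α p)) ∧
      0 < haarInf Γ (galImage Γ : Set (autInf Γ)) ∧
      galDensity Γ (prodSet Γ S) =
        (∑ᶠ χ : autInf Γ ⧸ galImage Γ →* ℤˣ,
          characterFactor S (χ.comp (QuotientGroup.mk' (galImage Γ)))) *
        naiveDensity Γ (prodSet Γ S) := by
  have hN := galImage_normal Γ
  have := finite_quotient_galImage hΓ
  have hX := finite_monoidHom_intUnits (Q := autInf Γ ⧸ galImage Γ)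
  have hcard := card_mul_measure_galImage hΓ
  have hG : (haarInf Γ).real (galImage Γ : Set (autInf Γ)) ≠ 0 := right_ne_zero_of_mul_eq_one hcard
  refine ⟨hN, hX, fun χ => ⟨continuous_primaryPart (isOpen_ker_comp_mk' hΓ χ), ?_⟩, ?_, ?_⟩
  · obtain ⟨I, hI, hprod⟩ := exists_finset_eq_prod_primaryPart (isOpen_ker_comp_mk' hΓ χ)
    refine ⟨I.finite_toSet.subset fun p hp => ?_, fun α => ?_⟩
    · by_contra hpI
      exact hp (hI p hpI)
    · refine (hprod α).trans (finprod_eq_prod_of_mulSupport_subset _ fun p hp => ?_).symm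
      by_contra hpI
      exact hp (DFunLike.congr_fun (hI p hpI) _)
  · exact pos_iff_ne_zero.2 fun h => hG (by rw [measureReal_def, h, ENNReal.toReal_zero])
  · -- measurable representatives of the sets `S p`
    choose T _ hTm hTS using fun p => (hS p).exists_measurable_superset_ae_eq
    have hae := prodSet_ae_eq hTS
    have hposT : ∀ p, 0 < haarPrim Γ p (T p) := fun p => by
      rw [measure_congr (hTS p)]
      exact hpos p
    have hsum := sum_setIntegral_character hΓ (prodSet Γ T)
    simp_rw [setIntegral_prodSet_character (isOpen_ker_comp_mk' hΓ _) hTm hposT] at hsum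
    rw [← finsum_mul] at hsum
    simp_rw [← fun χ => characterFactor_congr_ae hTS χ]
    rw [galDensity, naiveDensity, measureReal_congr (Filter.EventuallyEq.rfl.inter hae.symm),
      ← measureReal_congr hae, probReal_univ, div_one, hsum, div_eq_iff hG, mul_right_comm, hcard,
      one_mul]
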